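/- **Setting.** Let $X\in\mathbb R^{n\times q}$ have independent rows $X_i\sim\mathcal N(\mu_i,\sigma^2I_q)$, $i=1,\dots,n$, with unknown $\mu_i\in\mathbb R^q$ and unknown $\sigma>0$. For $A\in\mathbb R^{n\times q}$ let $\mathcal C(A)$ be the outcome of $J$ iterations of $K$-means clustering (Lloyd's algorithm, with initial centers given by a measurable function of $A$, ties broken in favour of the smallest index, and an empty cluster keeping its center) on the rows of $A$, i.e. the cluster assignments at the initialization and at every iteration, and let $\mathcal V(A)\subseteq\{(k,k'):1\le k<k'\le K\}$ be a measurable function of $A$ that selects the pairs of clusters to be tested. Let $\mathcal C_1,\dots,\mathcal C_K$ be the final clusters in $\mathcal C(X)$, let $\mathcal V=\mathcal V(X)$, and let $\mathcal K$ be the set of indices that occur in a pair of $\mathcal V$. Put $$\mathbf v_{k,k'}=\tfrac{1}{|\mathcal C_k|}\mathbf 1_{\mathcal C_k}-\tfrac1{|\mathcal C_{k'}|}\mathbf 1_{\mathcal C_{k'}},\quad \mathcal E=\mathrm{span}\{\mathbf v_{k,k'}:(k,k')\in\mathcal V\},\quad P_1=\sum_{k\in\mathcal K}\Big(I_{\mathcal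 C_k}-\tfrac{\mathbf 1_{\mathcal C_k}\mathbf 1_{\mathcal C_k}^\top}{|\mathcal C_k|}\Big),$$ let $P_{\mathcal E}$ be the orthogonal projection onto $\mathcal E$, $P_2=I_n-P_{\mathcal E}-P_1$, $d=q\dim\mathcal E$, $d^*=q\big(\sum_{k\in\mathcal K}|\mathcal C_k|-|\mathcal K|\big)$, $r^*=d^*/d$, and, with the Frobenius norm, $$T^*=\frac{\|P_{\mathcal E}X\|_F^2/d}{\|P_1X\|_F^2/d^*},\qquad Z^*=\Big(\tfrac{P_{\mathcal E}X}{\|P_{\mathcal E}X\|_F},\ \tfrac{P_1X}{\|P_1X\|_F},\ \|P_{\mathcal E}X\|_F^2+\|P_1X\|_F^2,\ P_2X\Big),$$ $$x^*(\psi)=\sqrt{\|P_{\mathcal E}X\|_F^2+\|P_1X\|_F^2}\left(\sqrt{\tfrac{\psi}{\psi+r^*}}\,\tfrac{P_{\mathcal E}X}{\|P_{\mathcal E}X\|_F}+\sqrt{\tfrac{r^*}{\psi+r^*}}\,\tfrac{P_1X}{\|P_1X\|_F}\right)+P_2X\qquad(\psi\ge0).$$ Let $\mathcal S^*=\{\psi\ge0:\mathcal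 C(X)=\mathcal C(x^*(\psi))\}$, $\mathcal S^*_{\mathcal V}=\{\psi\ge0:\mathcal V(X)=\mathcal V(x^*(\psi))\}$ and $\mathcal S^*_J=\mathcal S^*\cap\mathcal S^*_{\mathcal V}$. Let $Q^*_J$ be the conditional CDF of $T^*$ given $\mathcal C(X)$, $\mathcal V(X)$ and $Z^*$, and let $p^*_J=1-Q^*_J(T^*)$. The null hypothesis is $$H^*_{0,\mathcal V}:\quad \mu_i=\mu_{i'}\ \text{ for all } i,i'\in\mathcal C_k\cup\mathcal C_{k'}\text{ and }(k,k')\in\mathcal V .$$ **Theorem.** Almost surely on the event that $H^*_{0,\mathcal V}$ holds and the test is defined (that is, $\mathcal V\neq\emptyset$, $\mathcal C_k\ne\emptyset$ for all $k\in\mathcal K$, and $d^*>0$): 1. $Q^*_J(t)=F_{F_{d,d^*}}(t;\mathcal S^*_J)$ for all $t\in\mathbb R$, where $F_{F_{d,d^*}}(\cdot;\mathcal S)$ is the CDF of the $F_{d,d^*}$ distribution truncated to $\mathcal S$; 2. $\mathbb P\big(p^*_J\le\alpha\mid\mathcal C(X),\mathcal V(X)\big)=\alpha$ for every $\alpha\in[0,1]$,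 and likewise $\mathbb P\big(Q^*_J(T^*)\le\alpha\mid\mathcal C(X),\mathcal V(X)\big)=\alpha$. -/

import Mathlib

open MeasureTheory ProbabilityTheory

noncomputable section

namespace ClusterTest

/-- An `n × q` data matrix, given by its `n` rows (the observations) in `ℝ^q`. -/
abbrev Data (n q : ℕ) : Type := Fin n → EuclideanSpace ℝ (Fin q)

variable {n q K : ℕ}

/-- The squared Frobenius norm of a data matrix. -/
def frobSq (A : Data n q) : ℝ := ∑ i, ‖A i‖ ^ 2

/-- The Frobenius norm of a data matrix. -/
def frob (A : Data n q) : ℝ := Real.sqrt (frobSq A)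

/-- The product `M A` of an `n × n` matrix with a data matrix. -/
def lmul (M : Matrix (Fin n) (Fin n) ℝ) (A : Data n q) : Data n q :=
  fun i => ∑ j, M i j • A j

/-! ### K-means clustering (Lloyd's algorithm) -/

/-- The centers that are closest to `x`. -/
def nearestSet (m : Fin K → EuclideanSpace ℝ (Fin q)) (x : EuclideanSpace ℝ (Fin q)) :
    Finset (Fin K) := by
  classical exact Finset.univ.filter fun l => ∀ l', ‖x - m l‖ ≤ ‖x - m l'‖

theorem nearestSet_nonempty [NeZero K] (m : Fin K → EuclideanSpace ℝ (Fin q))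
    (x : EuclideanSpace ℝ (Fin q)) : (nearestSet m x).Nonempty := by
  classical
  obtain ⟨l, -, hl⟩ := Finset.exists_min_image (Finset.univ : Finset (Fin K))
    (fun l => ‖x - m l‖) Finset.univ_nonempty
  exact ⟨l, by simpa [nearestSet] using hl⟩

/-- The index of the center closest to `x`; ties are broken in favour of the smallest index. -/
def nearest [NeZero K] (m : Fin K → EuclideanSpace ℝ (Fin q)) (x : EuclideanSpace ℝ (Fin q)) :
    Fin K :=
  (nearestSet m x).min' (nearestSet_nonempty m x)

/-- The `l`-th cluster `C_l` of an assignment `c` of the observations to `K` clusters. -/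
def cluster (c : Fin n → Fin K) (l : Fin K) : Finset (Fin n) :=
  Finset.univ.filter fun i => c i = l

/-- One recentering step: a nonempty cluster gets the mean of its observations as new center,
an empty cluster keeps its old center. -/
def recenter (A : Data n q) (c : Fin n → Fin K) (m : Fin K → EuclideanSpace ℝ (Fin q)) :
    Fin K → EuclideanSpace ℝ (Fin q) := fun l =>
  if (cluster c l).Nonempty then ((cluster c l).card : ℝ)⁻¹ • ∑ i ∈ cluster c l, A i else m l

/-- The cluster centers after `j` steps of Lloyd's algorithm with initial centers `m`. -/
def centers [NeZero K] (A : Data n q) (m : Fin K → EuclideanSpace ℝ (Fin q)) :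
    ℕ → Fin K → EuclideanSpace ℝ (Fin q)
  | 0 => m
  | j + 1 => recenter A (fun i => nearest (centers A m j) (A i)) (centers A m j)

/-- The outcome `𝒞(A)` of `J` iterations of K-means clustering on the rows of `A`, with initial
centers `m₀ A`: the cluster assignments at the initialization (`j = 0`) and at every iteration
`j = 1, …, J`. -/
def kmeans [NeZero K] (m₀ : Data n q → Fin K → EuclideanSpace ℝ (Fin q)) (J : ℕ) (A : Data n q) :
    Fin (J + 1) → Fin n → Fin K :=
  fun j i => nearest (centers A (m₀ A) j) (A i)

/-- The clusters that are finally returned. -/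
def final {J : ℕ} (C : Fin (J + 1) → Fin n → Fin K) : Fin n → Fin K := C (Fin.last J)

/-! ### The test statistic

Here `c` is an assignment of the observations to clusters and `V` is a set of index pairs. -/

/-- The contrast vector `v_{k,k'} = 1_{C_k} / |C_k| - 1_{C_k'} / |C_k'|`. -/
def contrast (c : Fin n → Fin K) (k k' : Fin K) : EuclideanSpace ℝ (Fin n) :=
  WithLp.toLp 2 fun i =>
    (if c i = k then ((cluster c k).card : ℝ)⁻¹ else 0) -
      (if c i = k' then ((cluster c k').card : ℝ)⁻¹ else 0)

/-- The space `ℰ` spanned by the contrast vectors of the pairs in `V`. -/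
def contrastSpace (c : Fin n → Fin K) (V : Finset (Fin K × Fin K)) :
    Submodule ℝ (EuclideanSpace ℝ (Fin n)) :=
  Submodule.span ℝ {v | ∃ p ∈ V, v = contrast c p.1 p.2}

/-- The set `𝒦` of the indices of the tested clusters. -/
def tested (V : Finset (Fin K × Fin K)) : Finset (Fin K) :=
  Finset.univ.filter fun k => ∃ k', (k, k') ∈ V ∨ (k', k) ∈ V

/-- The matrix `P_ℰ` of the orthogonal projection onto `ℰ`. -/
def projE (c : Fin n → Fin K) (V : Finset (Fin K × Fin K)) : Matrix (Fin n) (Fin n) ℝ :=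
  (Matrix.toEuclideanCLM (n := Fin n) (𝕜 := ℝ)).symm (contrastSpace c V).starProjection

/-- The matrix `P₁ = ∑_{k ∈ 𝒦} (I_{C_k} - 1_{C_k} 1_{C_k}ᵀ / |C_k|)`. -/
def proj1 (c : Fin n → Fin K) (V : Finset (Fin K × Fin K)) : Matrix (Fin n) (Fin n) ℝ :=
  ∑ k ∈ tested V, Matrix.of fun i j =>
    (if i = j ∧ c i = k then (1 : ℝ) else 0) -
      (if c i = k ∧ c j = k then ((cluster c k).card : ℝ)⁻¹ else 0)

/-- The matrix `P₂ = I - P_ℰ - P₁`. -/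
def proj2 (c : Fin n → Fin K) (V : Finset (Fin K × Fin K)) : Matrix (Fin n) (Fin n) ℝ :=
  1 - projE c V - proj1 c V

/-- The degrees of freedom `d = q · dim ℰ`. -/
def dof (q : ℕ) (c : Fin n → Fin K) (V : Finset (Fin K × Fin K)) : ℕ :=
  q * Module.finrank ℝ (contrastSpace c V)

/-- The degrees of freedom `d* = q (∑_{k ∈ 𝒦} |C_k| - |𝒦|)`; used only when all tested clusters
are nonempty, so that the subtraction does not truncate. -/
def dofStar (q : ℕ) (c : Fin n → Fin K) (V : Finset (Fin K × Fin K)) : ℕ :=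
  q * (∑ k ∈ tested V, (cluster c k).card - (tested V).card)

/-- The statistic `T* = (‖P_ℰ X‖² / d) / (‖P₁ X‖² / d*)`. -/
def tStar (c : Fin n → Fin K) (V : Finset (Fin K × Fin K)) (X : Data n q) : ℝ :=
  (frobSq (lmul (projE c V) X) / dof q c V) / (frobSq (lmul (proj1 c V) X) / dofStar q c V)

/-- The statistic
`Z* = (P_ℰ X / ‖P_ℰ X‖, P₁ X / ‖P₁ X‖, ‖P_ℰ X‖² + ‖P₁ X‖², P₂ X)`. -/
def zStar (c : Fin n → Fin K) (V : Finset (Fin K × Fin K)) (X : Data n q) :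
    Data n q × Data n q × ℝ × Data n q :=
  ((frob (lmul (projE c V) X))⁻¹ • lmul (projE c V) X,
    (frob (lmul (proj1 c V) X))⁻¹ • lmul (proj1 c V) X,
    frobSq (lmul (projE c V) X) + frobSq (lmul (proj1 c V) X),
    lmul (proj2 c V) X)

/-- The perturbed data set `x*(ψ)`, with `r* = d* / d`. -/
def xStar (c : Fin n → Fin K) (V : Finset (Fin K × Fin K)) (X : Data n q) (ψ : ℝ) : Data n q :=
  let r : ℝ := dofStar q c V / dof q c V
  Real.sqrt (frobSq (lmul (projE c V) X) + frobSq (lmul (proj1 c V) X)) •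
      (Real.sqrt (ψ / (ψ + r)) • ((frob (lmul (projE c V) X))⁻¹ • lmul (projE c V) X) +
        Real.sqrt (r / (ψ + r)) • ((frob (lmul (proj1 c V) X))⁻¹ • lmul (proj1 c V) X)) +
    lmul (proj2 c V) X

/-- The truncation set `S*_J = {ψ ≥ 0 : 𝒞(X) = 𝒞(x*(ψ))} ∩ {ψ ≥ 0 : 𝒱(X) = 𝒱(x*(ψ))}`. -/
def truncSet {J : ℕ} (C : Data n q → Fin (J + 1) → Fin n → Fin K)
    (V : Data n q → Finset (Fin K × Fin K)) (X : Data n q) : Set ℝ :=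
  {ψ | 0 ≤ ψ ∧ C X = C (xStar (final (C X)) (V X) X ψ)} ∩
    {ψ | 0 ≤ ψ ∧ V X = V (xStar (final (C X)) (V X) X ψ)}

/-- The null hypothesis `H*_{0,V}`: `μ_i = μ_i'` whenever `i, i' ∈ C_k ∪ C_k'`, `(k, k') ∈ V`. -/
def NullStar (μ : Data n q) (c : Fin n → Fin K) (V : Finset (Fin K × Fin K)) : Prop :=
  ∀ p ∈ V, ∀ i ∈ cluster c p.1 ∪ cluster c p.2, ∀ i' ∈ cluster c p.1 ∪ cluster c p.2, μ i = μ i'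

/-- The test is defined: there is a pair to be tested, the tested clusters are nonempty, and
`d* > 0`, i.e. `q > 0` and not all of the tested clusters are singletons. -/
def WellPosed (q : ℕ) (c : Fin n → Fin K) (V : Finset (Fin K × Fin K)) : Prop :=
  V.Nonempty ∧ (∀ k ∈ tested V, (cluster c k).Nonempty) ∧ 0 < dofStar q c V

/-! ### Distributions -/

/-- The chi-squared distribution with `r` degrees of freedom. -/
def chiSq (r : ℕ) : Measure ℝ :=
  (Measure.pi fun _ : Fin r => gaussianReal 0 1).map fun z => ∑ i, z i ^ 2

/-- The `F` distribution: the law of `(U / a) / (W / b)` for independent `U ∼ χ²_a`, `W ∼ χ²_b`. -/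
def fDist (a b : ℕ) : Measure ℝ :=
  ((chiSq a).prod (chiSq b)).map fun p => (p.1 / a) / (p.2 / b)

/-- The distribution function of `ν` truncated to `S`: `t ↦ ν(S ∩ (-∞, t]) / ν(S)`. -/
def truncCDF (ν : Measure ℝ) (S : Set ℝ) (t : ℝ) : ℝ :=
  ν.real (S ∩ Set.Iic t) / ν.real S

/-- The conditional distribution function of the random variable `T` given the random
element `W`: the random function `ω ↦ (t ↦ P(T ≤ t | W)(ω))`. -/
def condDF {Ω β : Type*} [MeasurableSpace Ω] [MeasurableSpace β] (P : Measure Ω)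
    [IsFiniteMeasure P] (T : Ω → ℝ) (W : Ω → β) (ω : Ω) (t : ℝ) : ℝ :=
  cdf (condDistrib T W P (W ω)) t

/-- The statistic `T*` computed with the clusters and the pairs found in the data. -/
def selT {J : ℕ} (C : Data n q → Fin (J + 1) → Fin n → Fin K)
    (V : Data n q → Finset (Fin K × Fin K)) (X : Data n q) : ℝ :=
  tStar (final (C X)) (V X) X

/-- The conditioning variable `(𝒞(X), 𝒱(X), Z*)`. -/
def selW {J : ℕ} (C : Data n q → Fin (J + 1) → Fin n → Fin K)
    (V : Data n q → Finset (Fin K × Fin K)) (X : Data n q) :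
    (Fin (J + 1) → Fin n → Fin K) × Finset (Fin K × Fin K) ×
      (Data n q × Data n q × ℝ × Data n q) :=
  (C X, V X, zStar (final (C X)) (V X) X)

/-- The conditional distribution function `Q*_J` of `T*` given `𝒞(X)`, `𝒱(X)` and `Z*`. -/
def Qstar {Ω : Type*} [MeasurableSpace Ω] (P : Measure Ω) [IsFiniteMeasure P] {J : ℕ}
    (C : Data n q → Fin (J + 1) → Fin n → Fin K) (V : Data n q → Finset (Fin K × Fin K))
    (X : Ω → Data n q) (ω : Ω) (t : ℝ) : ℝ :=
  condDF P (fun ω' => selT C V (X ω')) (fun ω' => selW C V (X ω')) ω t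

/-- The p-value `p*_J = 1 - Q*_J(T*)`. -/
def pStar {Ω : Type*} [MeasurableSpace Ω] (P : Measure Ω) [IsFiniteMeasure P] {J : ℕ}
    (C : Data n q → Fin (J + 1) → Fin n → Fin K) (V : Data n q → Finset (Fin K × Fin K))
    (X : Ω → Data n q) (ω : Ω) : ℝ :=
  1 - Qstar P C V X ω (selT C V (X ω))

end ClusterTest

end

/-! Freeze one of the finitely many outcomes `(C₀, V₀)` of clustering and pair selection. If it
satisfies the null hypothesis and is well posed, `P_ℰ` and `P₁` are fixed symmetric idempotents with
product zero that annihilate `μ`: contrasts are constant on clusters, whereas `P₁` takes deviations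
from cluster means. Hence `P_ℰ X` and `P₁ X` are `σ` times the projections of a standard Gaussian
matrix onto orthogonal subspaces, whose dimensions are the traces `d` and `d*`. So the frozen `T*`
has the `F` law (`map_normSqRatio_stdGaussian`).

It is also independent of the frozen `Z*` (`indepFun_normSqRatio_polarRest`). The length of a
Gaussian vector is independent of its direction. Applied in each subspace, this separates the ratio
from the two directions; applied in their sum, it separates all scale-invariant quantities from the
total length. The remainder lives in the orthogonal complement.

Finally `x*(T*) = X` almost surely (`xStar_tStar`), so the event that the outcome is `(C₀, V₀)` says
exactly that `T*` lies in a set determined by `Z*`, namely the truncation set. Conditioning a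
variable on such an event and on an independent `Z*` truncates its law
(`condDistrib_eq_cond_section`), which gives the first claim. The truncated law has no atoms, so the
probability integral transform gives uniformity given `(𝒞, 𝒱, Z*)`, and the tower property removes
`Z*` (`condExp_condDF_uniform`). -/

noncomputable section

namespace ClusterTest

open scoped RealInnerProductSpace ENNReal

/-! ### Regrouping independent variables -/

section Independence

variable {Ω α β γ δ : Type*} [MeasurableSpace Ω] [MeasurableSpace α] [MeasurableSpace β]
  [MeasurableSpace γ] [MeasurableSpace δ] {P : Measure Ω}

theorem indepFun_comp_of_map {X : Ω → α} (hX : Measurable X) {f : α → β} {g : α → γ}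
    (hf : Measurable f) (hg : Measurable g) (h : IndepFun f g (P.map X)) :
    IndepFun (fun ω => f (X ω)) (fun ω => g (X ω)) P := by
  rw [indepFun_iff_measure_inter_preimage_eq_mul] at h ⊢
  intro s t hs ht
  have := h s t hs ht
  rwa [Measure.map_apply hX ((hf hs).inter (hg ht)), Measure.map_apply hX (hf hs),
    Measure.map_apply hX (hg ht)] at this

/-- The joint law is a triple product measure, and products of measures are associative. -/
theorem indepFun_prodMk_of_indepFun_prodMk [IsFiniteMeasure P] {X : Ω → α} {Y : Ω → β} {Z : Ω → γ}
    (hX : Measurable X) (hY : Measurable Y) (hZ : Measurable Z) (hXY : IndepFun X Y P)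
    (hXYZ : IndepFun (fun ω => (X ω, Y ω)) Z P) : IndepFun X (fun ω => (Y ω, Z ω)) P := by
  have hYZ : IndepFun Y Z P := hXYZ.comp measurable_snd measurable_id
  rw [indepFun_iff_map_prod_eq_prod_map_map (by fun_prop) (by fun_prop)] at *
  rw [hYZ, ← Measure.prodAssoc_prod, ← hXY, ← hXYZ, Measure.map_map (by fun_prop) (by fun_prop)]
  rfl

/-- The hypotheses make all four variables mutually independent, so they may be paired differently.
This is used to pair lengths with lengths and directions with directions. -/
theorem indepFun_prodMk_prodMk [IsFiniteMeasure P] {X : Ω → α} {X' : Ω → β} {Y : Ω → γ} {Y' : Ω → δ}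
    (hX : Measurable X) (hX' : Measurable X') (hY : Measurable Y) (hY' : Measurable Y')
    (h : IndepFun (fun ω => (X ω, X' ω)) (fun ω => (Y ω, Y' ω)) P)
    (hXX : IndepFun X X' P) (hYY : IndepFun Y Y' P) :
    IndepFun (fun ω => (X ω, Y ω)) (fun ω => (X' ω, Y' ω)) P := by
  have h1 : IndepFun X (fun ω => (X' ω, (Y ω, Y' ω))) P :=
    indepFun_prodMk_of_indepFun_prodMk hX hX' (hY.prodMk hY') hXX h
  have h2 : IndepFun Y (fun ω => (Y' ω, X' ω)) P :=
    indepFun_prodMk_of_indepFun_prodMk hY hY' hX' hYY (h.symm.comp measurable_id measurable_snd)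
  have h3 : IndepFun (fun ω => (Y' ω, X' ω)) (fun ω => (Y ω, X ω)) P := by
    refine (indepFun_prodMk_of_indepFun_prodMk (hY'.prodMk hX') hY hX h2.symm ?_)
    exact (h1.comp (φ := id) (ψ := fun p : β × γ × δ => ((p.2.2, p.1), p.2.1)) measurable_id
      (by fun_prop)).symm
  exact (h3.comp (φ := Prod.swap) (ψ := Prod.swap) measurable_swap measurable_swap).symm

end Independence

/-! ### Density and polar decomposition of the standard Gaussian -/

section Polar

variable {E : Type*} [NormedAddCommGroup E] [InnerProductSpace ℝ E] [FiniteDimensional ℝ E]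
  [MeasurableSpace E] [BorelSpace E]

/-- The density of the standard Gaussian distribution, as a function of the norm. -/
def gaussianRadial (d : ℕ) (r : ℝ) : ℝ := (2 * Real.pi) ^ (-(d / 2 : ℝ)) * Real.exp (-(r ^ 2) / 2)

theorem measurable_gaussianRadial (d : ℕ) : Measurable (gaussianRadial d) := by
  unfold gaussianRadial; fun_prop

theorem gaussianRadial_nonneg (d : ℕ) (r : ℝ) : 0 ≤ gaussianRadial d r := by
  unfold gaussianRadial; positivity

theorem integral_gaussianRadial_mul (t : E) :
    ∫ x : E, (gaussianRadial (Module.finrank ℝ E) ‖x‖ : ℂ) * Complex.exp (⟪x, t⟫ * Complex.I)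
      = Complex.exp (-‖t‖ ^ 2 / 2) := by
  have h := GaussianFourier.integral_cexp_neg_mul_sq_norm_add (b := 1 / 2) (V := E) (by norm_num)
    Complex.I t
  have h2 : ∀ x : E, (gaussianRadial (Module.finrank ℝ E) ‖x‖ : ℂ) *
      Complex.exp (⟪x, t⟫ * Complex.I) = ((2 * Real.pi) ^ (-(Module.finrank ℝ E / 2 : ℝ)) : ℝ) *
        Complex.exp (-(1 / 2) * ‖x‖ ^ 2 + Complex.I * ⟪t, x⟫) := by
    intro x
    rw [gaussianRadial, Complex.ofReal_mul, mul_assoc, Complex.ofReal_exp, ← Complex.exp_add,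
      real_inner_comm x t]
    congr 2
    push_cast
    ring
  simp_rw [h2]
  rw [integral_const_mul, h, ← mul_assoc]
  have h3 : (((2 * Real.pi) ^ (-(Module.finrank ℝ E / 2 : ℝ)) : ℝ) : ℂ) *
      (Real.pi / (1 / 2)) ^ ((Module.finrank ℝ E : ℂ) / 2) = 1 := by
    have : (Real.pi / (1 / 2) : ℂ) = ((2 * Real.pi : ℝ) : ℂ) := by push_cast; ring
    rw [this, Complex.ofReal_cpow (by positivity), ← Complex.cpow_add _ _ (by simp [Real.pi_ne_zero])]
    simp
  rw [h3, one_mul]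
  congr 1
  rw [Complex.I_sq]
  ring

theorem stdGaussian_eq_withDensity : stdGaussian E = (volume : Measure E).withDensity
    fun x => ENNReal.ofReal (gaussianRadial (Module.finrank ℝ E) ‖x‖) := by
  have hm : Measurable fun x : E => gaussianRadial (Module.finrank ℝ E) ‖x‖ :=
    (measurable_gaussianRadial _).comp measurable_norm
  have hI : Integrable (fun x : E => gaussianRadial (Module.finrank ℝ E) ‖x‖) := by
    -- The integral of a non-integrable function is 0 by convention, while the Fourier formula at `t
    -- = 0` gives 1.
    by_contra hI
    have h := integral_gaussianRadial_mul (0 : E)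
    simp only [inner_zero_right, Complex.ofReal_zero, zero_mul, Complex.exp_zero, mul_one,
      norm_zero] at h
    rw [integral_complex_ofReal, integral_undef hI] at h
    norm_num at h
  have : IsFiniteMeasure ((volume : Measure E).withDensity
      fun x => ENNReal.ofReal (gaussianRadial (Module.finrank ℝ E) ‖x‖)) :=
    isFiniteMeasure_withDensity_ofReal hI.2
  refine Measure.ext_of_charFun ?_
  ext t
  rw [charFun_stdGaussian, charFun_apply, integral_withDensity_eq_integral_toReal_smul
    (by fun_prop) (by simp)]
  simp_rw [ENNReal.toReal_ofReal (gaussianRadial_nonneg _ _), Complex.real_smul]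
  rw [integral_gaussianRadial_mul]

theorem stdGaussian_absolutelyContinuous : stdGaussian E ≪ (volume : Measure E) := by
  rw [stdGaussian_eq_withDensity]
  exact withDensity_absolutelyContinuous _ _

/-- The polar decomposition of a standard Gaussian vector: its norm and its direction are
independent. -/
theorem indepFun_norm_direction [Nontrivial E] :
    IndepFun (fun x : E => ‖x‖) (fun x : E => ‖x‖⁻¹ • x) (stdGaussian E) := by
  set f : ℝ → ℝ≥0∞ := fun r => ENNReal.ofReal (gaussianRadial (Module.finrank ℝ E) r)
  have hf : Measurable f := (measurable_gaussianRadial _).ennreal_ofReal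
  have hdir : Measurable fun x : E => ‖x‖⁻¹ • x := by fun_prop
  -- The density depends on the norm alone, so in polar coordinates the mass of a rectangle is an
  -- angular factor times a radial factor.
  have key : ∀ s : Set ℝ, ∀ t : Set E, MeasurableSet s → MeasurableSet t →
      stdGaussian E ((fun x : E => ‖x‖) ⁻¹' s ∩ (fun x : E => ‖x‖⁻¹ • x) ⁻¹' t) =
        (∫⁻ y, t.indicator 1 (y : E) ∂(volume : Measure E).toSphere) *
        ∫⁻ r, s.indicator f (r : ℝ) ∂Measure.volumeIoiPow (Module.finrank ℝ E - 1) := by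
    intro s t hs ht
    have hst := (measurable_norm (α := E) hs).inter (hdir ht)
    set g : E → ℝ≥0∞ := fun x => t.indicator 1 (‖x‖⁻¹ • x) * s.indicator f ‖x‖ with hg
    have hgm : Measurable g :=
      ((measurable_one.indicator ht).comp hdir).mul ((hf.indicator hs).comp measurable_norm)
    have e1 : stdGaussian E ((fun x : E => ‖x‖) ⁻¹' s ∩ (fun x : E => ‖x‖⁻¹ • x) ⁻¹' t) =
        ∫⁻ x, g x := by
      rw [stdGaussian_eq_withDensity, withDensity_apply _ hst, ← lintegral_indicator hst]
      congr 1
      ext x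
      by_cases h1 : ‖x‖ ∈ s <;> by_cases h2 : ‖x‖⁻¹ • x ∈ t <;> simp [g, h1, h2, f]
    rw [e1, ← lintegral_prod_mul (f := fun y : Metric.sphere (0 : E) 1 => t.indicator 1 (y : E))
      (g := fun r : Set.Ioi (0 : ℝ) => s.indicator f (r : ℝ))
      ((measurable_one.indicator ht).comp measurable_subtype_coe).aemeasurable
      ((hf.indicator hs).comp measurable_subtype_coe).aemeasurable,
      ← (volume : Measure E).measurePreserving_homeomorphUnitSphereProd.lintegral_comp_emb
        (Homeomorph.measurableEmbedding _)]
    -- Polar coordinates are a homeomorphism only away from the origin, which is a null set.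
    rw [← lintegral_add_compl g (measurableSet_singleton (0 : E)), Measure.restrict_singleton]
    simp only [measure_singleton, zero_smul, lintegral_zero_measure, zero_add]
    rw [← lintegral_subtype_comap (measurableSet_singleton _).compl]
    exact lintegral_congr fun x => by simp [g]
  rw [indepFun_iff_measure_inter_preimage_eq_mul]
  intro s t hs ht
  -- The two factors need not be normalized separately; `h4` says that their total masses multiply
  -- to 1.
  have h1 := key s t hs ht
  have h2 := key s Set.univ hs .univ
  have h3 := key Set.univ t .univ ht
  have h4 := key Set.univ Set.univ .univ .univ
  simp only [Set.preimage_univ, Set.inter_univ, Set.univ_inter, measure_univ] at h2 h3 h4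
  rw [h1, h2, h3, ← mul_one (_ * _), h4]
  ring

end Polar

/-! ### Linear images of a standard Gaussian -/

section Linear

variable {H E F : Type*} [NormedAddCommGroup H] [InnerProductSpace ℝ H] [FiniteDimensional ℝ H]
  [MeasurableSpace H] [BorelSpace H]
  [NormedAddCommGroup E] [InnerProductSpace ℝ E] [FiniteDimensional ℝ E]
  [MeasurableSpace E] [BorelSpace E]
  [NormedAddCommGroup F] [InnerProductSpace ℝ F] [FiniteDimensional ℝ F]
  [MeasurableSpace F] [BorelSpace F]

/-- Here `f'` is the adjoint of `f`: the characteristic function of the image at `s` is that of the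
source at `f' s`, which depends only on the norm. -/
theorem map_stdGaussian_of_inner {f : H → E} (hf : Measurable f) (f' : E → H)
    (hff' : ∀ x s, ⟪f x, s⟫ = ⟪x, f' s⟫) (hf' : ∀ s, ‖f' s‖ = ‖s‖) :
    (stdGaussian H).map f = stdGaussian E := by
  have := Measure.isProbabilityMeasure_map (μ := stdGaussian H) hf.aemeasurable
  refine Measure.ext_of_charFun ?_
  ext s
  rw [charFun_apply, integral_map hf.aemeasurable (by fun_prop)]
  simp_rw [hff']
  rw [← charFun_apply, charFun_stdGaussian, charFun_stdGaussian, hf']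

theorem charFun_map_stdGaussian_of_inner {f : H → E} (hf : Measurable f) (f' : E → H)
    (hff' : ∀ x s, ⟪f x, s⟫ = ⟪x, f' s⟫) (s : E) :
    charFun ((stdGaussian H).map f) s = Complex.exp (-‖f' s‖ ^ 2 / 2) := by
  rw [charFun_apply, integral_map hf.aemeasurable (by fun_prop)]
  simp_rw [hff']
  rw [← charFun_apply, charFun_stdGaussian]

/-- Orthogonality of the ranges of the adjoints makes the squared norm in the joint characteristic
function additive, so the exponential factors. -/
theorem indepFun_stdGaussian_of_inner {f : H → E} {g : H → F} (hf : Measurable f)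
    (hg : Measurable g) (f' : E → H) (g' : F → H)
    (hff' : ∀ x s, ⟪f x, s⟫ = ⟪x, f' s⟫) (hgg' : ∀ x s, ⟪g x, s⟫ = ⟪x, g' s⟫)
    (h : ∀ s t, ⟪f' s, g' t⟫ = 0) : IndepFun f g (stdGaussian H) := by
  rw [indepFun_iff_charFun_prod hf.aemeasurable hg.aemeasurable]
  intro t
  rw [charFun_map_stdGaussian_of_inner hf f' hff', charFun_map_stdGaussian_of_inner hg g' hgg',
    charFun_map_stdGaussian_of_inner (f := fun x => WithLp.toLp 2 (f x, g x)) (by fun_prop)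
      (fun t => f' t.ofLp.1 + g' t.ofLp.2), ← Complex.exp_add]
  · congr 1
    have := norm_add_sq_real (f' t.ofLp.1) (g' t.ofLp.2)
    rw [h] at this
    have h2 : ((‖f' t.ofLp.1 + g' t.ofLp.2‖ : ℂ)) ^ 2 = ‖f' t.ofLp.1‖ ^ 2 + ‖g' t.ofLp.2‖ ^ 2 := by
      norm_cast
      rw [this]; ring
    rw [h2]
    ring
  · intro x s
    rw [WithLp.prod_inner_apply, inner_add_right, hff', hgg']

end Linear

end ClusterTest

namespace ClusterTest

open scoped RealInnerProductSpace ENNReal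

/-! ### Chi-squared and F distributions have no atoms -/

section ChiSquared

instance isProbabilityMeasure_chiSq (r : ℕ) : IsProbabilityMeasure (chiSq r) :=
  Measure.isProbabilityMeasure_map (Measurable.aemeasurable (by fun_prop))

instance isProbabilityMeasure_fDist (a b : ℕ) : IsProbabilityMeasure (fDist a b) :=
  Measure.isProbabilityMeasure_map (Measurable.aemeasurable (by fun_prop))

theorem map_norm_sq_stdGaussian (E : Type*) [NormedAddCommGroup E] [InnerProductSpace ℝ E]
    [FiniteDimensional ℝ E] [MeasurableSpace E] [BorelSpace E] :
    (stdGaussian E).map (fun x => ‖x‖ ^ 2) = chiSq (Module.finrank ℝ E) := by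
  rw [stdGaussian, chiSq, Measure.map_map (by fun_prop) (by fun_prop)]
  congr 1
  ext x
  have := (stdOrthonormalBasis ℝ E).sum_sq_norm_inner_right (∑ i, x i • stdOrthonormalBasis ℝ E i)
  simp only [Function.comp_apply]
  rw [← this]
  refine Finset.sum_congr rfl fun i _ => ?_
  rw [(stdOrthonormalBasis ℝ E).orthonormal.inner_right_fintype]
  simp

theorem nullSet_norm_sq_eq {E : Type*} [NormedAddCommGroup E] [InnerProductSpace ℝ E]
    [FiniteDimensional ℝ E] [MeasurableSpace E] [BorelSpace E] [Nontrivial E] (u : ℝ) :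
    stdGaussian E {x | ‖x‖ ^ 2 = u} = 0 := by
  apply stdGaussian_absolutelyContinuous
  refine measure_mono_null (t := Metric.sphere 0 (√u)) (fun x hx => ?_)
    (Measure.addHaar_sphere volume 0 (√u))
  simp only [Set.mem_ofPred_eq] at hx
  simp [← hx]

theorem noAtoms_chiSq {r : ℕ} (hr : 0 < r) : NullSingletonClass (chiSq r) := by
  have : Nonempty (Fin r) := ⟨⟨0, hr⟩⟩
  have h := map_norm_sq_stdGaussian (EuclideanSpace ℝ (Fin r))
  rw [finrank_euclideanSpace_fin] at h
  rw [← h]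
  refine ⟨fun u => ?_⟩
  rw [Measure.map_apply (by fun_prop) (measurableSet_singleton u)]
  exact nullSet_norm_sq_eq u

theorem noAtoms_fDist {a b : ℕ} (ha : 0 < a) (hb : 0 < b) : NullSingletonClass (fDist a b) := by
  have := noAtoms_chiSq ha
  have := noAtoms_chiSq hb
  refine ⟨fun t => ?_⟩
  have hm : Measurable fun p : ℝ × ℝ => (p.1 / a) / (p.2 / b) := by fun_prop
  rw [fDist, Measure.map_apply hm (measurableSet_singleton t),
    Measure.measure_prod_null (hm (measurableSet_singleton t))]
  have h0 : ∀ᵐ x ∂chiSq a, x ≠ 0 := by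
    rw [ae_iff]; simp
  filter_upwards [h0] with x hx
  -- For fixed nonzero numerator the ratio determines the denominator, except that `y = 0` also
  -- gives ratio 0 under the division convention. A two-point set is null.
  have hsub : Prod.mk x ⁻¹' ((fun p : ℝ × ℝ => (p.1 / a) / (p.2 / b)) ⁻¹' {t}) ⊆
      {0, x / a * b / t} := by
    intro y hy
    simp only [Set.mem_preimage, Set.mem_singleton_iff, Set.mem_insert_iff] at hy ⊢
    by_cases hy0 : y = 0
    · exact Or.inl hy0
    right
    have ha' : (a : ℝ) ≠ 0 := by positivity
    have hb' : (b : ℝ) ≠ 0 := by positivity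
    rw [← hy]
    field_simp
  exact measure_mono_null hsub ((Set.toFinite _).measure_zero _)

end ChiSquared

/-! ### The ratio of projections is independent of the remaining data -/

section Ratio

variable {H : Type*} [NormedAddCommGroup H] [InnerProductSpace ℝ H] [FiniteDimensional ℝ H]
  [MeasurableSpace H] [BorelSpace H]

/-- The ratio of the normalized squared norms of the projections of `x` to `U` and `V`. -/
def normSqRatio (U V : Submodule ℝ H) (x : H) : ℝ :=
  (‖U.starProjection x‖ ^ 2 / Module.finrank ℝ U) / (‖V.starProjection x‖ ^ 2 / Module.finrank ℝ V)

/-- The directions of the projections of `x` to `U` and `V`, the sum of their squared norms, and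
what is left of `x`. -/
def polarRest (U V : Submodule ℝ H) (x : H) : H × H × ℝ × H :=
  (‖U.starProjection x‖⁻¹ • U.starProjection x, ‖V.starProjection x‖⁻¹ • V.starProjection x,
    ‖U.starProjection x‖ ^ 2 + ‖V.starProjection x‖ ^ 2,
    x - U.starProjection x - V.starProjection x)

theorem measurable_normSqRatio (U V : Submodule ℝ H) : Measurable (normSqRatio U V) := by
  unfold normSqRatio; fun_prop

theorem measurable_polarRest (U V : Submodule ℝ H) : Measurable (polarRest U V) := by
  unfold polarRest; fun_prop

theorem map_orthogonalProjectionOnto_stdGaussian (U : Submodule ℝ H) :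
    (stdGaussian H).map U.orthogonalProjectionOnto = stdGaussian U :=
  map_stdGaussian_of_inner (by fun_prop) (fun s => (s : H))
    (fun x s => U.inner_orthogonalProjectionOnto_eq_of_mem_right s x) (fun s => rfl)

theorem indepFun_orthogonalProjectionOnto {U V : Submodule ℝ H} (hUV : U ⟂ V) :
    IndepFun U.orthogonalProjectionOnto V.orthogonalProjectionOnto (stdGaussian H) :=
  indepFun_stdGaussian_of_inner (by fun_prop) (by fun_prop) (fun s => (s : H)) (fun s => (s : H))
    (fun x s => U.inner_orthogonalProjectionOnto_eq_of_mem_right s x)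
    (fun x s => V.inner_orthogonalProjectionOnto_eq_of_mem_right s x)
    (fun s t => hUV.inner_eq s.2 t.2)

theorem ae_orthogonalProjectionOnto_ne_zero {U : Submodule ℝ H} (hU : 0 < Module.finrank ℝ U) :
    ∀ᵐ x ∂stdGaussian H, U.starProjection x ≠ 0 := by
  have : Nontrivial U := Module.nontrivial_of_finrank_pos hU
  have h := nullSet_norm_sq_eq (E := U) 0
  rw [← map_orthogonalProjectionOnto_stdGaussian, Measure.map_apply (by fun_prop)
    (measurableSet_eq_fun (by fun_prop) (by fun_prop))] at h
  rw [ae_iff]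
  refine measure_mono_null (fun x hx => ?_) h
  have hx' : U.starProjection x = 0 := not_not.mp hx
  change ‖U.starProjection x‖ ^ 2 = 0
  rw [hx', norm_zero, zero_pow two_ne_zero]

theorem map_normSqRatio_stdGaussian {U V : Submodule ℝ H} (hUV : U ⟂ V) :
    (stdGaussian H).map (normSqRatio U V) = fDist (Module.finrank ℝ U) (Module.finrank ℝ V) := by
  have h := (indepFun_orthogonalProjectionOnto hUV).comp (φ := fun x => ‖x‖ ^ 2)
    (ψ := fun x => ‖x‖ ^ 2) (by fun_prop) (by fun_prop)
  rw [indepFun_iff_map_prod_eq_prod_map_map (by fun_prop) (by fun_prop)] at h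
  rw [← Measure.map_map (by fun_prop) (by fun_prop), ← Measure.map_map (by fun_prop) (by fun_prop),
    map_orthogonalProjectionOnto_stdGaussian, map_orthogonalProjectionOnto_stdGaussian,
    map_norm_sq_stdGaussian, map_norm_sq_stdGaussian] at h
  rw [fDist, ← h, Measure.map_map (by fun_prop) (by fun_prop)]
  rfl

/-- The components of `polarRest` are adjoined one at a time: the directions (`h2`), the total
length (`h5`), the remainder (`h7`). Each step needs the new component to be independent of the
ratio together with those already adjoined. -/
theorem indepFun_normSqRatio_polarRest {U V : Submodule ℝ H} (hUV : U ⟂ V)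
    (hU : 0 < Module.finrank ℝ U) (hV : 0 < Module.finrank ℝ V) :
    IndepFun (normSqRatio U V) (polarRest U V) (stdGaussian H) := by
  have : Nontrivial U := Module.nontrivial_of_finrank_pos hU
  have : Nontrivial V := Module.nontrivial_of_finrank_pos hV
  have hdir : ∀ W : Submodule ℝ H, Nontrivial W → IndepFun
      (fun x : H => ‖W.orthogonalProjectionOnto x‖)
      (fun x : H => ‖W.orthogonalProjectionOnto x‖⁻¹ • W.orthogonalProjectionOnto x)
      (stdGaussian H) := by
    intro W _
    refine indepFun_comp_of_map (X := W.orthogonalProjectionOnto) (f := fun y => ‖y‖)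
      (g := fun y => ‖y‖⁻¹ • y) (by fun_prop) (by fun_prop) (by fun_prop) ?_
    rw [map_orthogonalProjectionOnto_stdGaussian]
    exact indepFun_norm_direction
  have h1 := indepFun_prodMk_prodMk (by fun_prop) (by fun_prop) (by fun_prop) (by fun_prop)
    ((indepFun_orthogonalProjectionOnto hUV).comp
      (φ := fun y => (‖y‖, ‖y‖⁻¹ • y)) (ψ := fun y => (‖y‖, ‖y‖⁻¹ • y)) (by fun_prop) (by fun_prop))
    (hdir U inferInstance) (hdir V inferInstance)
  have h2 : IndepFun (normSqRatio U V) (fun x =>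
      (‖U.orthogonalProjectionOnto x‖⁻¹ • U.orthogonalProjectionOnto x,
        ‖V.orthogonalProjectionOnto x‖⁻¹ • V.orthogonalProjectionOnto x)) (stdGaussian H) :=
    h1.comp (φ := fun p : ℝ × ℝ => (p.1 ^ 2 / Module.finrank ℝ U) / (p.2 ^ 2 / Module.finrank ℝ V))
      (ψ := id) (by fun_prop) measurable_id
  -- The adjoint of `w` is `(u, v) ↦ u + v`, an isometry because `U ⟂ V`; so `w` is standard
  -- Gaussian and the polar decomposition applies to it.
  let w : H → WithLp 2 (U × V) := fun x =>
    WithLp.toLp 2 (U.orthogonalProjectionOnto x, V.orthogonalProjectionOnto x)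
  have hw : Measurable w := by unfold w; fun_prop
  have hin : ∀ x s, ⟪w x, s⟫ = ⟪x, (s.ofLp.1 : H) + (s.ofLp.2 : H)⟫ := by
    intro x s
    rw [WithLp.prod_inner_apply, inner_add_right]
    exact congrArg₂ _ (U.inner_orthogonalProjectionOnto_eq_of_mem_right _ x)
      (V.inner_orthogonalProjectionOnto_eq_of_mem_right _ x)
  have hnw : ∀ x, ‖w x‖ ^ 2 = ‖U.starProjection x‖ ^ 2 + ‖V.starProjection x‖ ^ 2 := fun x => by
    rw [WithLp.prod_norm_sq_eq_of_L2]; rfl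
  have hlaw : (stdGaussian H).map w = stdGaussian (WithLp 2 (U × V)) := by
    refine map_stdGaussian_of_inner hw _ hin fun s => ?_
    rw [← sq_eq_sq₀ (norm_nonneg _) (norm_nonneg _), WithLp.prod_norm_sq_eq_of_L2,
      norm_add_sq_real, hUV.inner_eq s.ofLp.1.2 s.ofLp.2.2]
    simp
  have : Nontrivial (WithLp 2 (U × V)) := (WithLp.equiv 2 (U × V)).nontrivial
  have h3 : IndepFun (fun x => ‖w x‖) (fun x => ‖w x‖⁻¹ • w x) (stdGaussian H) := by
    refine indepFun_comp_of_map (X := w) (f := fun y => ‖y‖)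
      (g := fun y => ‖y‖⁻¹ • y) hw (by fun_prop) (by fun_prop) ?_
    rw [hlaw]
    exact indepFun_norm_direction
  have hhom : ∀ {W : Submodule ℝ H} (r : ℝ) (y : W), 0 < r →
      ‖r⁻¹ • y‖⁻¹ • (r⁻¹ • y) = ‖y‖⁻¹ • y := by
    intro W r y hr
    rw [norm_smul, norm_inv, Real.norm_of_nonneg hr.le, smul_smul]
    congr 1
    field_simp
  have h4 : IndepFun (fun x => (normSqRatio U V x,
      (‖U.orthogonalProjectionOnto x‖⁻¹ • U.orthogonalProjectionOnto x,
        ‖V.orthogonalProjectionOnto x‖⁻¹ • V.orthogonalProjectionOnto x)))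
      (fun x => ‖w x‖) (stdGaussian H) := by
    -- The ratio and both directions are invariant under scaling, hence functions of the direction
    -- of `w`. At `w x = 0` the identity persists, since every term is 0 by convention.
    have := (h3.comp (φ := id) (ψ := fun u : WithLp 2 (U × V) =>
      ((‖u.ofLp.1‖ ^ 2 / Module.finrank ℝ U) / (‖u.ofLp.2‖ ^ 2 / Module.finrank ℝ V),
        (‖u.ofLp.1‖⁻¹ • u.ofLp.1, ‖u.ofLp.2‖⁻¹ • u.ofLp.2))) measurable_id (by fun_prop)).symm
    convert this using 1
    swap
    · rfl
    ext1 x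
    rcases eq_or_ne (w x) 0 with h0 | h0
    · have ha : U.orthogonalProjectionOnto x = 0 := congrArg (fun u => u.ofLp.1) h0
      have hb : V.orthogonalProjectionOnto x = 0 := congrArg (fun u => u.ofLp.2) h0
      simp [h0, ha, hb, normSqRatio, Submodule.starProjection_apply]
    · have hr : 0 < ‖w x‖ := norm_pos_iff.mpr h0
      have e1 : ((‖w x‖⁻¹ • w x).ofLp).1 = ‖w x‖⁻¹ • U.orthogonalProjectionOnto x := rfl
      have e2 : ((‖w x‖⁻¹ • w x).ofLp).2 = ‖w x‖⁻¹ • V.orthogonalProjectionOnto x := rfl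
      simp only [Function.comp_apply, e1, e2, hhom _ _ hr]
      rw [norm_smul, norm_smul, norm_inv, norm_norm]
      refine Prod.ext ?_ rfl
      simp only [normSqRatio, Submodule.starProjection_apply, Submodule.coe_norm]
      field_simp
  have h5 := indepFun_prodMk_of_indepFun_prodMk (measurable_normSqRatio U V) (by fun_prop)
    (by fun_prop) h2 h4
  -- The remainder is a self-adjoint function of `x` that takes values in the orthogonal complement
  -- of `U` and `V`.
  have h6 : IndepFun w (fun x : H => x - U.starProjection x - V.starProjection x)
      (stdGaussian H) := by
    refine indepFun_stdGaussian_of_inner hw (by fun_prop) _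
      (fun x : H => x - U.starProjection x - V.starProjection x) hin ?_ ?_
    · intro x s
      simp only [inner_sub_left, inner_sub_right, Submodule.inner_starProjection_left_eq_right]
    · intro s t
      have a1 : U.starProjection (s.ofLp.1 : H) = s.ofLp.1 :=
        Submodule.starProjection_eq_self_iff.2 s.ofLp.1.2
      have a2 : V.starProjection (s.ofLp.2 : H) = s.ofLp.2 :=
        Submodule.starProjection_eq_self_iff.2 s.ofLp.2.2
      have a3 : U.starProjection (s.ofLp.2 : H) = 0 :=
        (Submodule.starProjection_apply_eq_zero_iff U).2 (hUV.symm s.ofLp.2.2)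
      have a4 : V.starProjection (s.ofLp.1 : H) = 0 :=
        (Submodule.starProjection_apply_eq_zero_iff V).2 (hUV s.ofLp.1.2)
      simp only [inner_sub_right, ← Submodule.inner_starProjection_left_eq_right, map_add, a1, a2,
        a3, a4, zero_add, add_zero, inner_add_left]
      ring
  have h7 := indepFun_prodMk_of_indepFun_prodMk (measurable_normSqRatio U V) (by fun_prop)
    (by fun_prop) h5 (h6.comp (φ := fun u : WithLp 2 (U × V) =>
      ((‖u.ofLp.1‖ ^ 2 / Module.finrank ℝ U) / (‖u.ofLp.2‖ ^ 2 / Module.finrank ℝ V),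
        ((‖u.ofLp.1‖⁻¹ • u.ofLp.1, ‖u.ofLp.2‖⁻¹ • u.ofLp.2), ‖u‖))) (ψ := id) (by fun_prop)
        measurable_id)
  have h8 := h7.comp (φ := id) (ψ := fun p : ((U × V) × ℝ) × H =>
    ((p.1.1.1 : H), (p.1.1.2 : H), p.1.2 ^ 2, p.2)) measurable_id (by fun_prop)
  refine Eq.mp (congrArg (IndepFun (normSqRatio U V) · _) ?_) h8
  ext1 x
  simp only [Function.comp_apply, hnw]
  rfl

end Ratio

end ClusterTest

namespace ClusterTest

open scoped ENNReal Topology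

/-! ### Probability integral transform -/

section IntegralTransform

theorem continuous_cdf_of_nullSingleton (ν : Measure ℝ) [IsProbabilityMeasure ν]
    [NullSingletonClass ν] : Continuous (cdf ν) := by
  refine continuous_iff_continuousAt.2 fun a => ?_
  rw [(monotone_cdf ν).continuousAt_iff_leftLim_eq_rightLim, (cdf ν).rightLim_eq]
  refine le_antisymm ((monotone_cdf ν).leftLim_le le_rfl) ?_
  have h : (cdf ν).measure {a} = 0 := by rw [measure_cdf]; simp
  rw [StieltjesFunction.measure_singleton, ENNReal.ofReal_eq_zero] at h
  linarith

/-- The probability integral transform. -/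
theorem measure_cdf_le (ν : Measure ℝ) [IsProbabilityMeasure ν] [NullSingletonClass ν] {α : ℝ}
    (hα : α ∈ Set.Icc (0 : ℝ) 1) : ν {t | cdf ν t ≤ α} = ENNReal.ofReal α := by
  have hc := continuous_cdf_of_nullSingleton ν
  rcases hα.2.eq_or_lt with rfl | h1
  · simp [cdf_le_one]
  set A := {t | cdf ν t ≤ α} with hA
  have hcl : IsClosed A := isClosed_le hc continuous_const
  obtain ⟨M, hM⟩ := ((tendsto_cdf_atTop ν).eventually (lt_mem_nhds h1)).exists
  have hbdd : BddAbove A := ⟨M, fun t ht => le_of_not_gt fun h =>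
    (hM.trans_le (monotone_cdf ν h.le)).not_ge ht⟩
  rcases A.eq_empty_or_nonempty with he | hne
  · have h0 : α = 0 := by
      by_contra h0
      obtain ⟨t, ht⟩ := ((tendsto_cdf_atBot ν).eventually
        (gt_mem_nhds (lt_of_le_of_ne hα.1 (Ne.symm h0)))).exists
      exact he.subset (show t ∈ A from ht.le)
    rw [he, h0]; simp
  · have hs : sSup A ∈ A := hcl.csSup_mem hne hbdd
    have hAI : A = Set.Iic (sSup A) := Set.Subset.antisymm (fun t ht => le_csSup hbdd ht)
      fun t ht => (monotone_cdf ν ht).trans hs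
    -- If the value at the supremum were below `α`, continuity would put points to its right into
    -- the sublevel set.
    have heq : cdf ν (sSup A) = α := by
      refine le_antisymm hs (le_of_not_gt fun h => ?_)
      obtain ⟨t, ht, ht'⟩ := ((eventually_nhdsWithin_of_eventually_nhds
        (hc.continuousAt.eventually (gt_mem_nhds h))).and
        (self_mem_nhdsWithin : Set.Ioi (sSup A) ∈ 𝓝[>] (sSup A))).exists
      exact (le_csSup hbdd (show t ∈ A from ht.le)).not_gt ht'
    rw [hAI, ← ofReal_cdf, heq]

/-- Reflection `t ↦ -t` turns the survival function into a distribution function; the endpoint does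
not matter because there are no atoms. -/
theorem measure_one_sub_cdf_le (ν : Measure ℝ) [IsProbabilityMeasure ν] [NullSingletonClass ν]
    {α : ℝ} (hα : α ∈ Set.Icc (0 : ℝ) 1) : ν {t | 1 - cdf ν t ≤ α} = ENNReal.ofReal α := by
  have : IsProbabilityMeasure (ν.map Neg.neg) :=
    Measure.isProbabilityMeasure_map measurable_neg.aemeasurable
  have : NullSingletonClass (ν.map Neg.neg) := ⟨fun x => by
    rw [Measure.map_apply measurable_neg (measurableSet_singleton x)]
    simp⟩
  have h : ∀ t, cdf (ν.map Neg.neg) (-t) = 1 - cdf ν t := fun t => by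
    rw [cdf_eq_real, cdf_eq_real, map_measureReal_apply measurable_neg measurableSet_Iic,
      ← probReal_compl_eq_one_sub measurableSet_Iic]
    have : Neg.neg ⁻¹' Set.Iic (-t) = Set.Ici t := by ext; simp
    rw [this, Set.compl_Iic]
    exact measureReal_congr Ioi_ae_eq_Ici.symm
  rw [← measure_cdf_le (ν.map Neg.neg) hα, Measure.map_apply measurable_neg
    (measurableSet_le (monotone_cdf _).measurable measurable_const)]
  congr 1
  ext t
  simp [h]

end IntegralTransform

/-! ### Conditional laws under selection -/

section Conditional

variable {Ω β γ L : Type*} [MeasurableSpace Ω] [MeasurableSpace β] [MeasurableSpace γ]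
  [MeasurableSpace L] {P : Measure Ω} [IsProbabilityMeasure P]

theorem measurable_cdf_kernel (κ : Kernel β ℝ) [IsMarkovKernel κ] :
    Measurable fun p : β × ℝ => cdf (κ p.1) p.2 := by
  have h : ∀ p : β × ℝ, cdf (κ p.1) p.2 =
      ((Kernel.prodMkRight ℝ κ) p (Prod.mk p ⁻¹' {x : (β × ℝ) × ℝ | x.2 ≤ x.1.2})).toReal :=
    fun p => cdf_eq_real _ _
  simp_rw [h]
  exact (Kernel.measurable_kernel_prodMk_left
    (measurableSet_le measurable_snd (measurable_snd.comp measurable_fst))).ennreal_toReal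

/-- Tower property, localized: the conditional probability given `W` equals `α` on the event `φ W ∈
s`, and this event is measurable for the coarser σ-algebra, so its indicator passes through the
outer conditional expectation. -/
theorem condExp_comap_eq_const_of_kernel {W : Ω → β} {T : Ω → ℝ} (hW : Measurable W)
    (hT : Measurable T) {φ : β → L} (hφ : Measurable φ) {s : Set L} (hs : MeasurableSet s)
    {D : Set (β × ℝ)} (hD : MeasurableSet D) {α : ℝ}
    (h : ∀ᵐ ω ∂P, φ (W ω) ∈ s → (condDistrib T W P (W ω)).real (Prod.mk (W ω) ⁻¹' D) = α) :
    ∀ᵐ ω ∂P, φ (W ω) ∈ s →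
      (P⟦{ω' | (W ω', T ω') ∈ D} | MeasurableSpace.comap (fun ω' => φ (W ω')) inferInstance⟧) ω
        = α := by
  have hle : MeasurableSpace.comap (fun ω' => φ (W ω')) inferInstance ≤
      MeasurableSpace.comap W inferInstance := by
    rw [← Function.comp_def φ W, ← MeasurableSpace.comap_comp]
    exact MeasurableSpace.comap_mono hφ.comap_le
  have hle0 := hle.trans hW.comap_le
  set E := {ω' | (W ω', T ω') ∈ D}
  have hE : MeasurableSet E := (hW.prodMk hT) hD
  set f : Ω → ℝ := E.indicator fun _ => 1
  have hf : Integrable f P := (integrable_const _).indicator hE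
  have h1 : P[f | MeasurableSpace.comap W inferInstance] =ᵐ[P]
      fun ω => (condDistrib T W P (W ω)).real (Prod.mk (W ω) ⁻¹' D) := by
    have := condExp_prod_ae_eq_integral_condDistrib (μ := P) (f := D.indicator fun _ => (1 : ℝ)) hW
      hT.aemeasurable (stronglyMeasurable_const.indicator hD) hf
    refine this.trans (Filter.Eventually.of_forall fun ω => ?_)
    have h2 : ∀ y, D.indicator (fun _ => (1 : ℝ)) (W ω, y) =
        (Prod.mk (W ω) ⁻¹' D).indicator (fun _ => 1) y := fun y => rfl
    simp_rw [h2]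
    rw [integral_indicator (measurable_prodMk_left hD)]
    simp
  set G := (fun ω => φ (W ω)) ⁻¹' s
  have hG0 : MeasurableSet G := (hφ.comp hW) hs
  have hGi : Integrable (G.indicator fun _ => α) P := (integrable_const _).indicator hG0
  set m := MeasurableSpace.comap (fun ω' => φ (W ω')) (inferInstance : MeasurableSpace L)
  have hG : MeasurableSet[m] G := ⟨s, hs, rfl⟩
  have h3 : P[P[f | MeasurableSpace.comap W inferInstance] | m] =ᵐ[P] P[f | m] :=
    condExp_condExp_of_le hle hW.comap_le
  set g := P[f | MeasurableSpace.comap W inferInstance]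
  have h4 : G.indicator g =ᵐ[P] G.indicator fun _ => α := by
    filter_upwards [h1, h] with ω hω hω'
    by_cases hG' : ω ∈ G
    · simp only [Set.indicator_of_mem hG', hω]
      exact hω' hG'
    · simp only [Set.indicator_of_notMem hG']
  have h5 := condExp_indicator (m := m) (μ := P) (f := g) integrable_condExp hG
  have h6 := condExp_congr_ae (m := m) h4
  have h7 : P[G.indicator fun _ => α | m] = G.indicator fun _ => α :=
    condExp_of_stronglyMeasurable hle0 (stronglyMeasurable_const.indicator hG) hGi
  rw [h7] at h6
  filter_upwards [h3, h5, h6] with ω h3 h5 h6 hω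
  have hω : ω ∈ G := hω
  rw [← h3]
  rw [h5, Set.indicator_of_mem hω, Set.indicator_of_mem hω] at h6
  exact h6

/-- Where the conditional law of `T` given `W` has no atoms, the conditional distribution function
evaluated at `T` is uniformly distributed given any coarser statistic `φ W`. -/
theorem condExp_condDF_uniform {W : Ω → β} {T : Ω → ℝ} (hW : Measurable W)
    (hT : Measurable T) {φ : β → L} (hφ : Measurable φ) {s : Set L} (hs : MeasurableSet s)
    (h : ∀ᵐ ω ∂P, φ (W ω) ∈ s → NullSingletonClass (condDistrib T W P (W ω))) {α : ℝ}
    (hα : α ∈ Set.Icc (0 : ℝ) 1) :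
    ∀ᵐ ω ∂P, φ (W ω) ∈ s →
      (P⟦{ω' | 1 - condDF P T W ω' (T ω') ≤ α} |
        MeasurableSpace.comap (fun ω' => φ (W ω')) inferInstance⟧) ω = α ∧
      (P⟦{ω' | condDF P T W ω' (T ω') ≤ α} |
        MeasurableSpace.comap (fun ω' => φ (W ω')) inferInstance⟧) ω = α := by
  have hm := measurable_cdf_kernel (condDistrib T W P)
  have h1 := condExp_comap_eq_const_of_kernel (P := P) (α := α) hW hT hφ hs
    (D := {p | 1 - cdf (condDistrib T W P p.1) p.2 ≤ α})
    (measurableSet_le (measurable_const.sub hm) measurable_const) (by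
      filter_upwards [h] with ω hω hs
      have := hω hs
      rw [measureReal_def]
      exact (congrArg _ (measure_one_sub_cdf_le _ hα)).trans (ENNReal.toReal_ofReal hα.1))
  have h2 := condExp_comap_eq_const_of_kernel (P := P) (α := α) hW hT hφ hs
    (D := {p | cdf (condDistrib T W P p.1) p.2 ≤ α})
    (measurableSet_le hm measurable_const) (by
      filter_upwards [h] with ω hω hs
      have := hω hs
      rw [measureReal_def]
      exact (congrArg _ (measure_cdf_le _ hα)).trans (ENNReal.toReal_ofReal hα.1))
  filter_upwards [h1, h2] with ω h1 h2 hs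
  exact ⟨h1 hs, h2 hs⟩

/-- If `T₀` is independent of `Z₀` and if, on the event `W ∈ B`, which is the event
`(Z₀, T₀) ∈ D`, one has `T = T₀` and `W = e Z₀`, then the conditional law of `T` given `W` is on
this event the law of `T₀` truncated to the section of `D` at `Z₀`. -/
theorem condDistrib_eq_cond_section {T₀ T : Ω → ℝ} {Z₀ : Ω → γ} {W : Ω → β}
    (hT₀ : Measurable T₀) (hT : Measurable T) (hZ₀ : Measurable Z₀) (hW : Measurable W)
    (hind : IndepFun T₀ Z₀ P) {B : Set β} (hB : MeasurableSet B) {D : Set (γ × ℝ)}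
    (hD : MeasurableSet D) {e : γ → β} (he : Measurable e) {g : β → γ} (hg : Measurable g)
    (hge : ∀ z, g (e z) = z) (hBD : ∀ᵐ ω ∂P, W ω ∈ B ↔ (Z₀ ω, T₀ ω) ∈ D)
    (hTW : ∀ᵐ ω ∂P, W ω ∈ B → W ω = e (Z₀ ω) ∧ T ω = T₀ ω) :
    ∀ᵐ ω ∂P, W ω ∈ B →
      condDistrib T W P (W ω) = cond (P.map T₀) (Prod.mk (Z₀ ω) ⁻¹' D) := by
  classical
  have hF : IsProbabilityMeasure (P.map T₀) := Measure.isProbabilityMeasure_map hT₀.aemeasurable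
  set F := P.map T₀
  have hsec : ∀ z, MeasurableSet (Prod.mk z ⁻¹' D) := fun z => measurable_prodMk_left hD
  have hFD : Measurable fun z => F (Prod.mk z ⁻¹' D) := measurable_measure_prodMk_left hD
  let κ₀ : Kernel γ ℝ :=
    ⟨fun z => cond F (Prod.mk z ⁻¹' D), by
      refine Measure.measurable_of_measurable_coe _ fun s hs => ?_
      simp_rw [fun z => cond_apply (hsec z) F s]
      exact hFD.inv.mul (measurable_measure_prodMk_left (hD.inter (measurable_snd hs)))⟩
  have hκ₀ : ∀ z, κ₀ z = cond F (Prod.mk z ⁻¹' D) := fun z => rfl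
  -- Where the section of `D` is null, `cond` is the zero measure; hence the kernel is only finite,
  -- not Markov.
  have : IsFiniteKernel κ₀ := ⟨1, ENNReal.one_lt_top, fun z => by
    rw [hκ₀, cond_apply (hsec z), Set.inter_univ]
    exact ENNReal.inv_mul_le_one _⟩
  -- Off `B` nothing is claimed, so the true conditional law is kept there. If this patched kernel
  -- disintegrates the joint law (`hmain`), uniqueness of the disintegration identifies it on `B`.
  let κ : Kernel β ℝ := Kernel.piecewise hB (κ₀.comap g hg) (condDistrib T W P)
  have hmain : P.map (fun ω => (W ω, T ω)) = P.map W ⊗ₘ κ := by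
    have hcd : (P.map W) ⊗ₘ condDistrib T W P = P.map fun ω => (W ω, T ω) :=
      compProd_map_condDistrib hT.aemeasurable
    ext s hs
    have hκm : Measurable fun b => κ b (Prod.mk b ⁻¹' s) := Kernel.measurable_kernel_prodMk_left hs
    rw [Measure.compProd_apply hs, ← lintegral_add_compl _ hB]
    have hc : ∫⁻ b in Bᶜ, κ b (Prod.mk b ⁻¹' s) ∂P.map W =
        P.map (fun ω => (W ω, T ω)) (s ∩ Prod.fst ⁻¹' Bᶜ) := by
      rw [← hcd, Measure.compProd_apply (hs.inter (measurable_fst hB.compl)),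
        ← lintegral_indicator hB.compl]
      refine lintegral_congr fun b => ?_
      by_cases hb : b ∈ B
      · have : Prod.mk b ⁻¹' (s ∩ Prod.fst ⁻¹' Bᶜ) = (∅ : Set ℝ) := by ext; simp [hb]
        rw [this, measure_empty, Set.indicator_of_notMem (by simpa using hb)]
      · have : Prod.mk b ⁻¹' (s ∩ Prod.fst ⁻¹' Bᶜ) = (Prod.mk b ⁻¹' s : Set ℝ) := by
          ext; simp [hb]
        rw [this, Set.indicator_of_mem (by simpa using hb)]
        simp [hb, κ, Kernel.piecewise_apply]
    have hb : ∫⁻ b in B, κ b (Prod.mk b ⁻¹' s) ∂P.map W =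
        P.map (fun ω => (W ω, T ω)) (s ∩ Prod.fst ⁻¹' B) := by
      set h : γ → ℝ≥0∞ := fun z => κ₀ z (Prod.mk (e z) ⁻¹' s) with hh
      have hes : MeasurableSet {p : γ × ℝ | (e p.1, p.2) ∈ s} :=
        ((he.comp measurable_fst).prodMk measurable_snd) hs
      have hhm : Measurable h :=
        Kernel.measurable_kernel_prodMk_left (κ := κ₀) (t := {p : γ × ℝ | (e p.1, p.2) ∈ s}) hes
      have hhD : Measurable (D.indicator fun p : γ × ℝ => h p.1) :=
        (hhm.comp measurable_fst).indicator hD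
      have hprod : P.map (fun ω => (Z₀ ω, T₀ ω)) = (P.map Z₀).prod F :=
        hind.symm.map_prod_eq_prod_map_map hZ₀.aemeasurable hT₀.aemeasurable
      calc ∫⁻ b in B, κ b (Prod.mk b ⁻¹' s) ∂P.map W
          = ∫⁻ ω, B.indicator (fun b => κ b (Prod.mk b ⁻¹' s)) (W ω) ∂P := by
            rw [← lintegral_indicator hB, lintegral_map (hκm.indicator hB) hW]
        _ = ∫⁻ ω, D.indicator (fun p => h p.1) (Z₀ ω, T₀ ω) ∂P := by
            refine lintegral_congr_ae ?_
            filter_upwards [hBD, hTW] with ω h1 h2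
            by_cases hω : W ω ∈ B
            · rw [Set.indicator_of_mem hω, Set.indicator_of_mem (h1.1 hω)]
              obtain ⟨h3, -⟩ := h2 hω
              simp only [κ, Kernel.piecewise_apply, if_pos hω, Kernel.comap_apply, hh]
              rw [h3, hge]
            · rw [Set.indicator_of_notMem hω, Set.indicator_of_notMem (fun h => hω (h1.2 h))]
        _ = ∫⁻ p, D.indicator (fun p => h p.1) p ∂(P.map Z₀).prod F := by
            rw [← hprod, lintegral_map hhD (hZ₀.prodMk hT₀)]
        _ = ∫⁻ z, h z * F (Prod.mk z ⁻¹' D) ∂P.map Z₀ := by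
            rw [lintegral_prod _ hhD.aemeasurable]
            refine lintegral_congr fun z => ?_
            have : ∀ t, D.indicator (fun p => h p.1) (z, t) =
                (Prod.mk z ⁻¹' D).indicator (fun _ => h z) t := fun t => rfl
            simp_rw [this]
            rw [lintegral_indicator_const (hsec z)]
        _ = ∫⁻ z, F (Prod.mk z ⁻¹' (D ∩ {p : γ × ℝ | (e p.1, p.2) ∈ s})) ∂P.map Z₀ := by
            refine lintegral_congr fun z => ?_
            rw [hh]
            simp only [hκ₀, cond_apply (hsec z)]
            have hpre : Prod.mk z ⁻¹' (D ∩ {p : γ × ℝ | (e p.1, p.2) ∈ s}) =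
                Prod.mk z ⁻¹' D ∩ Prod.mk (e z) ⁻¹' s := rfl
            rw [hpre]
            -- The normalizing constant cancels when it is nonzero; otherwise both sides vanish.
            rcases eq_or_ne (F (Prod.mk z ⁻¹' D)) 0 with h0 | h0
            · rw [h0, mul_zero, measure_mono_null Set.inter_subset_left h0]
            · rw [mul_right_comm, ENNReal.inv_mul_cancel h0 (measure_ne_top _ _), one_mul]
        _ = P.map (fun ω => (Z₀ ω, T₀ ω)) (D ∩ {p : γ × ℝ | (e p.1, p.2) ∈ s}) := by
            rw [hprod, Measure.prod_apply (hD.inter hes)]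
        _ = P.map (fun ω => (W ω, T ω)) (s ∩ Prod.fst ⁻¹' B) := by
            rw [Measure.map_apply (hZ₀.prodMk hT₀) (hD.inter hes),
              Measure.map_apply (hW.prodMk hT) (hs.inter (measurable_fst hB))]
            refine measure_congr ?_
            filter_upwards [hBD, hTW] with ω h1 h2
            apply propext
            change ((Z₀ ω, T₀ ω) ∈ D ∧ (e (Z₀ ω), T₀ ω) ∈ s) ↔ ((W ω, T ω) ∈ s ∧ W ω ∈ B)
            by_cases hω : W ω ∈ B
            · obtain ⟨h3, h4⟩ := h2 hω
              rw [h4, ← h3]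
              simp [hω, h1.1 hω]
            · simp [hω, mt h1.2 hω]
    rw [hb, hc, ← measure_inter_add_sdiff s (measurable_fst hB)]
    rfl
  have h1 := ae_of_ae_map hW.aemeasurable
    (condDistrib_ae_eq_of_measure_eq_compProd (κ := κ) W hT.aemeasurable hmain)
  filter_upwards [h1, hTW] with ω h1 h2 hω
  rw [h1]
  simp only [κ, Kernel.piecewise_apply, if_pos hω, Kernel.comap_apply, hκ₀]
  rw [(h2 hω).1, hge]

end Conditional

end ClusterTest

namespace ClusterTest

/-! ### Measurability of clustering and of the statistics -/

section Measurability

variable {n q K : ℕ}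

/-- Handles matrices and statistics that depend on the data through cluster labels: there are only
countably many label values, and each gives a measurable map. -/
theorem measurable_comp_of_countable {α β L : Type*} [MeasurableSpace α] [MeasurableSpace β]
    [MeasurableSpace L] [Countable L] [MeasurableSingletonClass L] {ℓ : α → L} (hℓ : Measurable ℓ)
    {f : L → α → β} (hf : ∀ l, Measurable (f l)) : Measurable fun a => f (ℓ a) a :=
  (measurable_from_prod_countable_right (f := fun p : L × α => f p.1 p.2) hf).comp
    (hℓ.prodMk measurable_id)

theorem measurable_nearest [NeZero K] {α : Type*} [MeasurableSpace α]
    {m : α → Fin K → EuclideanSpace ℝ (Fin q)} (hm : Measurable m)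
    {x : α → EuclideanSpace ℝ (Fin q)} (hx : Measurable x) :
    Measurable fun a => nearest (m a) (x a) := by
  have hmem : ∀ l, MeasurableSet {a | l ∈ nearestSet (m a) (x a)} := by
    intro l
    have : {a | l ∈ nearestSet (m a) (x a)} = ⋂ l', {a | ‖x a - m a l‖ ≤ ‖x a - m a l'‖} := by
      ext a; simp [nearestSet]
    rw [this]
    exact MeasurableSet.iInter fun l' => measurableSet_le (by fun_prop) (by fun_prop)
  refine measurable_to_countable' fun l => ?_
  have : (fun a => nearest (m a) (x a)) ⁻¹' {l} = {a | l ∈ nearestSet (m a) (x a)} ∩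
      ⋂ l' ∈ Set.Iio l, {a | l' ∈ nearestSet (m a) (x a)}ᶜ := by
    ext a
    simp only [Set.mem_preimage, Set.mem_singleton_iff, nearest, Set.mem_inter_iff,
      Set.mem_ofPred_eq, Set.mem_iInter, Set.mem_compl_iff, Set.mem_Iio]
    constructor
    · rintro rfl
      exact ⟨Finset.min'_mem _ _, fun l' hl' h => (Finset.min'_le _ _ h).not_gt hl'⟩
    · rintro ⟨h1, h2⟩
      exact le_antisymm (Finset.min'_le _ _ h1)
        (le_of_not_gt fun h => h2 _ h (Finset.min'_mem _ _))
  rw [this]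
  exact (hmem l).inter (MeasurableSet.biInter (Set.to_countable _) fun l' _ => (hmem l').compl)

theorem measurable_recenter {α : Type*} [MeasurableSpace α] {A : α → Data n q} (hA : Measurable A)
    {c : α → Fin n → Fin K} (hc : Measurable c) {m : α → Fin K → EuclideanSpace ℝ (Fin q)}
    (hm : Measurable m) : Measurable fun a => recenter (A a) (c a) (m a) := by
  refine measurable_comp_of_countable (f := fun c a => recenter (A a) c (m a)) hc fun c => ?_
  refine measurable_pi_lambda _ fun l => ?_
  unfold recenter
  split_ifs <;> fun_prop

theorem measurable_centers [NeZero K] {m₀ : Data n q → Fin K → EuclideanSpace ℝ (Fin q)}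
    (hm₀ : Measurable m₀) (j : ℕ) : Measurable fun A => centers A (m₀ A) j := by
  induction j with
  | zero => exact hm₀
  | succ j ih =>
    exact measurable_recenter measurable_id
      (measurable_pi_lambda _ fun i => measurable_nearest ih (by fun_prop)) ih

theorem measurable_kmeans [NeZero K] {m₀ : Data n q → Fin K → EuclideanSpace ℝ (Fin q)}
    (hm₀ : Measurable m₀) (J : ℕ) : Measurable (kmeans m₀ J) :=
  measurable_pi_lambda _ fun j => measurable_pi_lambda _ fun i =>
    measurable_nearest (measurable_centers hm₀ j) (by fun_prop)

theorem measurable_lmul (M : Matrix (Fin n) (Fin n) ℝ) :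
    Measurable (lmul M : Data n q → Data n q) := by
  unfold lmul; fun_prop

theorem measurable_frobSq : Measurable (frobSq : Data n q → ℝ) := by
  unfold frobSq; fun_prop

theorem measurable_frob : Measurable (frob : Data n q → ℝ) :=
  measurable_frobSq.sqrt

theorem measurable_tStar (c : Fin n → Fin K) (V : Finset (Fin K × Fin K)) :
    Measurable (tStar c V : Data n q → ℝ) :=
  ((measurable_frobSq.comp (measurable_lmul _)).div_const _).div
    ((measurable_frobSq.comp (measurable_lmul _)).div_const _)

theorem measurable_zStar (c : Fin n → Fin K) (V : Finset (Fin K × Fin K)) :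
    Measurable (zStar c V : Data n q → _) :=
  (((measurable_frob.comp (measurable_lmul _)).inv.smul (measurable_lmul _))).prodMk
    ((((measurable_frob.comp (measurable_lmul _)).inv.smul (measurable_lmul _))).prodMk
      (((measurable_frobSq.comp (measurable_lmul _)).add
        (measurable_frobSq.comp (measurable_lmul _))).prodMk (measurable_lmul _)))

/-- The data set with `T* = ψ` and `Z* = z`. -/
def rebuild (r : ℝ) (z : Data n q × Data n q × ℝ × Data n q) (ψ : ℝ) : Data n q :=
  Real.sqrt z.2.2.1 • (Real.sqrt (ψ / (ψ + r)) • z.1 + Real.sqrt (r / (ψ + r)) • z.2.1) + z.2.2.2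

theorem measurable_rebuild (r : ℝ) :
    Measurable fun p : (Data n q × Data n q × ℝ × Data n q) × ℝ => rebuild r p.1 p.2 := by
  unfold rebuild
  fun_prop

theorem xStar_eq_rebuild (c : Fin n → Fin K) (V : Finset (Fin K × Fin K)) (X : Data n q) (ψ : ℝ) :
    xStar c V X ψ = rebuild ((dofStar q c V : ℝ) / dof q c V) (zStar c V X) ψ := rfl

variable {J : ℕ} {C : Data n q → Fin (J + 1) → Fin n → Fin K} {V : Data n q → Finset (Fin K × Fin K)}

theorem measurable_selT (hC : Measurable C) (hV : Measurable V) : Measurable (selT C V) :=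
  measurable_comp_of_countable (f := fun l : (Fin (J + 1) → Fin n → Fin K) × Finset (Fin K × Fin K) =>
    (tStar (final l.1) l.2 : Data n q → ℝ)) (hC.prodMk hV) fun _ => measurable_tStar _ _

theorem measurable_selW (hC : Measurable C) (hV : Measurable V) : Measurable (selW C V) :=
  hC.prodMk (hV.prodMk (measurable_comp_of_countable
    (f := fun l : (Fin (J + 1) → Fin n → Fin K) × Finset (Fin K × Fin K) =>
      (zStar (final l.1) l.2 : Data n q → _)) (hC.prodMk hV) fun _ => measurable_zStar _ _))

end Measurability

end ClusterTest

namespace ClusterTest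

open scoped RealInnerProductSpace

/-! ### Matrices acting on data matrices -/

section Operators

variable {n q K : ℕ}

/-- The space of data matrices with the Frobenius inner product. -/
abbrev FrobSpace (n q : ℕ) : Type := PiLp 2 fun _ : Fin n => EuclideanSpace ℝ (Fin q)

theorem norm_sq_toLp (A : Data n q) : ‖(WithLp.toLp 2 A : FrobSpace n q)‖ ^ 2 = frobSq A :=
  PiLp.norm_sq_eq_of_L2 _ _

theorem norm_toLp (A : Data n q) : ‖(WithLp.toLp 2 A : FrobSpace n q)‖ = frob A := by
  rw [frob, ← norm_sq_toLp, Real.sqrt_sq (norm_nonneg _)]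

/-- Left multiplication by a matrix as an operator on the space of data matrices. -/
def lmulOp (q : ℕ) (M : Matrix (Fin n) (Fin n) ℝ) : FrobSpace n q →ₗ[ℝ] FrobSpace n q where
  toFun x := WithLp.toLp 2 (lmul M x.ofLp)
  map_add' x y := by
    ext i : 1
    simp [lmul, Finset.sum_add_distrib]
  map_smul' a x := by
    ext i : 1
    simp [lmul, Finset.smul_sum, smul_comm a]

theorem lmulOp_apply (M : Matrix (Fin n) (Fin n) ℝ) (x : FrobSpace n q) :
    lmulOp q M x = WithLp.toLp 2 (lmul M x.ofLp) := rfl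

theorem lmul_mul (M N : Matrix (Fin n) (Fin n) ℝ) (A : Data n q) :
    lmul (M * N) A = lmul M (lmul N A) := by
  ext i : 1
  simp only [lmul, Matrix.mul_apply, Finset.sum_smul, Finset.smul_sum, smul_smul]
  exact Finset.sum_comm

theorem lmul_apply_apply (M : Matrix (Fin n) (Fin n) ℝ) (A : Data n q) (i : Fin n) (a : Fin q) :
    lmul M A i a = M.mulVec (fun j => A j a) i := by
  simp [lmul, Matrix.mulVec, dotProduct]

theorem lmul_zero (A : Data n q) : lmul (0 : Matrix (Fin n) (Fin n) ℝ) A = 0 := by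
  ext i : 1
  simp [lmul]

theorem inner_lmulOp_left (M : Matrix (Fin n) (Fin n) ℝ) (x y : FrobSpace n q) :
    ⟪lmulOp q M x, y⟫ = ⟪x, lmulOp q M.transpose y⟫ := by
  rw [PiLp.inner_apply, PiLp.inner_apply]
  simp only [lmulOp_apply, lmul, sum_inner, inner_sum, real_inner_smul_left,
    real_inner_smul_right, Matrix.transpose_apply]
  exact Finset.sum_comm

theorem isSymmetricProjection_lmulOp {M : Matrix (Fin n) (Fin n) ℝ} (hM : M.transpose = M)
    (hM2 : M * M = M) : (lmulOp q M).IsSymmetricProjection where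
  isIdempotentElem := by
    ext1 x
    change lmulOp q M (lmulOp q M x) = lmulOp q M x
    rw [lmulOp_apply, lmulOp_apply, ← lmul_mul, hM2]
  isSymmetric x y := by
    rw [inner_lmulOp_left, hM]

theorem starProjection_range_lmulOp {M : Matrix (Fin n) (Fin n) ℝ} (hM : M.transpose = M)
    (hM2 : M * M = M) (x : FrobSpace n q) :
    (lmulOp q M).range.starProjection x = WithLp.toLp 2 (lmul M x.ofLp) := by
  obtain ⟨_, h⟩ := LinearMap.isSymmetricProjection_iff_eq_coe_starProjection_range.1
    (isSymmetricProjection_lmulOp (q := q) hM hM2)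
  exact (congrArg (fun f => f x) h).symm

/-- The operator acts as `M` on each of the `q` columns. As the rank of an idempotent is its trace,
this produces the factor `q` in the degrees of freedom. -/
theorem trace_lmulOp (M : Matrix (Fin n) (Fin n) ℝ) :
    LinearMap.trace ℝ _ (lmulOp q M) = q * M.trace := by
  rw [LinearMap.trace_eq_sum_inner _ (Pi.orthonormalBasis fun _ : Fin n =>
    EuclideanSpace.basisFun (Fin q) ℝ), Fintype.sum_sigma, Matrix.trace, Finset.mul_sum]
  refine Finset.sum_congr rfl fun i _ => ?_
  have : ∀ a : Fin q, ⟪(Pi.orthonormalBasis fun _ : Fin n => EuclideanSpace.basisFun (Fin q) ℝ)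
      ⟨i, a⟩, lmulOp q M ((Pi.orthonormalBasis fun _ : Fin n => EuclideanSpace.basisFun (Fin q) ℝ)
      ⟨i, a⟩)⟫ = M i i := by
    intro a
    rw [Pi.orthonormalBasis_apply, PiLp.inner_apply, Finset.sum_eq_single i]
    · rw [lmulOp_apply]
      simp only [lmul]
      rw [Finset.sum_eq_single i]
      · simp [real_inner_smul_right]
      · intro j _ hj
        simp [hj]
      · simp
    · intro j _ hj
      simp [hj]
    · simp
  rw [Finset.sum_congr rfl fun a _ => this a]
  simp

theorem finrank_range_lmulOp {M : Matrix (Fin n) (Fin n) ℝ} (hM2 : M * M = M) :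
    (Module.finrank ℝ (lmulOp q M).range : ℝ) = q * M.trace := by
  have hid : IsIdempotentElem (lmulOp q M) := by
    ext1 x
    change lmulOp q M (lmulOp q M x) = lmulOp q M x
    rw [lmulOp_apply, lmulOp_apply, ← lmul_mul, hM2]
  rw [← trace_lmulOp, (LinearMap.IsIdempotentElem.isProj_range _ hid).trace]

end Operators

/-! ### Algebra of `P_ℰ` and `P₁`, and their effect on the mean -/

section Projections

variable {n q K : ℕ} (c : Fin n → Fin K) (V : Finset (Fin K × Fin K))

theorem transpose_projE : (projE c V).transpose = projE c V := by
  have h : star (projE c V) = projE c V := by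
    have hs := StarHomClass.map_star (Matrix.toEuclideanCLM (n := Fin n) (𝕜 := ℝ)) (projE c V)
    refine (Matrix.toEuclideanCLM (n := Fin n) (𝕜 := ℝ)).injective (hs.trans ?_)
    rw [projE, StarAlgEquiv.apply_symm_apply,
      (isStarProjection_starProjection).isSelfAdjoint.star_eq]
    exact ((Matrix.toEuclideanCLM (n := Fin n) (𝕜 := ℝ)).apply_symm_apply _).symm
  rwa [Matrix.star_eq_conjTranspose, Matrix.conjTranspose_eq_transpose_of_trivial] at h

theorem projE_mul_projE : projE c V * projE c V = projE c V := by
  rw [projE, ← map_mul, (Submodule.isIdempotentElem_starProjection _).eq]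

theorem toLp_projE_mulVec (v : Fin n → ℝ) :
    WithLp.toLp 2 ((projE c V).mulVec v) = (contrastSpace c V).starProjection (WithLp.toLp 2 v) := by
  rw [← Matrix.toEuclideanCLM_toLp (𝕜 := ℝ), projE, StarAlgEquiv.apply_symm_apply]

theorem trace_projE : (projE c V).trace = Module.finrank ℝ (contrastSpace c V) := by
  have h1 := ((contrastSpace c V).isSymmetricProjection_starProjection).isIdempotentElem
  have h2 := (LinearMap.IsIdempotentElem.isProj_range _ h1).trace
  have h3 : (((contrastSpace c V).starProjection : EuclideanSpace ℝ (Fin n) →L[ℝ] _) :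
      EuclideanSpace ℝ (Fin n) →ₗ[ℝ] _).range = contrastSpace c V :=
    Submodule.range_starProjection _
  rw [h3] at h2
  rw [← h2, LinearMap.trace_eq_sum_inner _ (EuclideanSpace.basisFun (Fin n) ℝ), Matrix.trace]
  refine Finset.sum_congr rfl fun i _ => ?_
  have := toLp_projE_mulVec c V (Pi.single i 1)
  have h4 : (EuclideanSpace.basisFun (Fin n) ℝ) i = WithLp.toLp 2 (Pi.single i (1 : ℝ)) := by
    simp
  rw [h4, ContinuousLinearMap.coe_coe, ← this]
  simp [PiLp.inner_apply]

theorem proj1_apply (i j : Fin n) : proj1 c V i j = if c i ∈ tested V then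
    (if i = j then (1 : ℝ) else 0) - (if c j = c i then ((cluster c (c i)).card : ℝ)⁻¹ else 0)
    else 0 := by
  rw [proj1, Matrix.sum_apply]
  simp only [Matrix.of_apply]
  by_cases hi : c i ∈ tested V
  · rw [if_pos hi, Finset.sum_eq_single (c i)]
    · simp
    · intro k _ hk
      simp [hk.symm]
    · exact fun h => absurd hi h
  · rw [if_neg hi]
    refine Finset.sum_eq_zero fun k hk => ?_
    have : c i ≠ k := fun h => hi (h ▸ hk)
    simp [this]

theorem sum_cluster_ite (l : Fin K) (f : Fin n → ℝ) :
    ∑ j, (if c j = l then f j else 0) = ∑ j ∈ cluster c l, f j := by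
  rw [cluster, Finset.sum_filter]

theorem proj1_mulVec (v : Fin n → ℝ) (i : Fin n) : (proj1 c V).mulVec v i = if c i ∈ tested V then
    v i - ((cluster c (c i)).card : ℝ)⁻¹ * ∑ j ∈ cluster c (c i), v j else 0 := by
  simp only [Matrix.mulVec, dotProduct, proj1_apply]
  split_ifs with hi
  · simp only [sub_mul, Finset.sum_sub_distrib, ite_mul, one_mul, zero_mul,
      Finset.sum_ite_eq, Finset.mem_univ, if_true]
    rw [sum_cluster_ite, Finset.mul_sum]
  · simp

theorem transpose_proj1 : (proj1 c V).transpose = proj1 c V := by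
  ext i j
  rw [Matrix.transpose_apply, proj1_apply, proj1_apply]
  by_cases h : c i = c j
  · simp [h, eq_comm]
  · have h' : i ≠ j := fun e => h (e ▸ rfl)
    simp [h, h', Ne.symm h, Ne.symm h']

theorem self_mem_cluster (i : Fin n) : i ∈ cluster c (c i) := by simp [cluster]

theorem mem_cluster {i : Fin n} {l : Fin K} : i ∈ cluster c l ↔ c i = l := by simp [cluster]

theorem card_cluster_ne_zero (i : Fin n) : ((cluster c (c i)).card : ℝ) ≠ 0 :=
  Nat.cast_ne_zero.2 (Finset.card_ne_zero_of_mem (self_mem_cluster c i))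

/-- On a tested cluster `P₁` subtracts the cluster mean, and elsewhere it gives 0. Idempotence, `P₁
P_ℰ = 0` and `P₁ μ = 0` all reduce to this. -/
theorem proj1_mulVec_eq_zero {v : Fin n → ℝ} (hv : ∀ i j, c i ∈ tested V → c j = c i → v j = v i) :
    (proj1 c V).mulVec v = 0 := by
  ext i
  rw [proj1_mulVec]
  split_ifs with hi
  · rw [Finset.sum_congr rfl fun j hj => hv i j hi ((mem_cluster c).1 hj), Finset.sum_const,
      nsmul_eq_mul, inv_mul_cancel_left₀ (card_cluster_ne_zero c i), sub_self, Pi.zero_apply]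
  · rfl

theorem proj1_mul_proj1 : proj1 c V * proj1 c V = proj1 c V := by
  refine Matrix.ext_of_mulVec_single fun k => ?_
  set w : Fin n → ℝ := Pi.single k (1 : ℝ)
  rw [← Matrix.mulVec_mulVec]
  -- On a tested cluster `P₁ w - w` is minus the cluster mean, hence constant there.
  have h : (proj1 c V).mulVec ((proj1 c V).mulVec w - w) = 0 := by
    have : (proj1 c V).mulVec ((proj1 c V).mulVec w - w) = (proj1 c V).mulVec
        (fun i => if c i ∈ tested V then
          -(((cluster c (c i)).card : ℝ)⁻¹ * ∑ j ∈ cluster c (c i), w j) else -w i) := by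
      congr 1
      ext i
      rw [Pi.sub_apply, proj1_mulVec]
      split_ifs <;> ring
    rw [this]
    refine proj1_mulVec_eq_zero c V fun i j hi hj => ?_
    simp only [hj]
    simp [hi]
  rw [Matrix.mulVec_sub, sub_eq_zero] at h
  exact h

theorem trace_proj1 (hne : ∀ k ∈ tested V, (cluster c k).Nonempty) :
    (proj1 c V).trace = ((∑ k ∈ tested V, (cluster c k).card - (tested V).card : ℕ) : ℝ) := by
  have hle : (tested V).card ≤ ∑ k ∈ tested V, (cluster c k).card := by
    rw [Finset.card_eq_sum_ones]
    exact Finset.sum_le_sum fun k hk => (hne k hk).card_pos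
  rw [Nat.cast_sub hle, Matrix.trace]
  simp only [Matrix.diag_apply, proj1, Matrix.sum_apply, Matrix.of_apply, true_and, and_self]
  rw [Finset.sum_comm, Finset.card_eq_sum_ones]
  push_cast
  rw [← Finset.sum_sub_distrib]
  refine Finset.sum_congr rfl fun k hk => ?_
  rw [Finset.sum_sub_distrib, sum_cluster_ite, sum_cluster_ite]
  have : ((cluster c k).card : ℝ) ≠ 0 := Nat.cast_ne_zero.2 (hne k hk).card_ne_zero
  simp [this]

theorem proj1_mulVec_of_mem {v : EuclideanSpace ℝ (Fin n)} (hv : v ∈ contrastSpace c V) :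
    (proj1 c V).mulVec v.ofLp = 0 := by
  refine proj1_mulVec_eq_zero c V fun i j _ hj => ?_
  induction hv using Submodule.span_induction with
  | mem x hx =>
    obtain ⟨p, _, rfl⟩ := hx
    simp [contrast, hj]
  | zero => rfl
  | add x y _ _ hx hy => simp [hx, hy]
  | smul a x _ hx => simp [hx]

theorem proj1_mul_projE : proj1 c V * projE c V = 0 := by
  refine Matrix.ext_of_mulVec_single fun k => ?_
  rw [← Matrix.mulVec_mulVec, Matrix.zero_mulVec]
  have h := toLp_projE_mulVec c V (Pi.single k 1)
  have := proj1_mulVec_of_mem c V (v := WithLp.toLp 2 ((projE c V).mulVec (Pi.single k 1))) (by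
    rw [h]; exact Submodule.starProjection_apply_mem _ _)
  exact this

theorem projE_mul_proj1 : projE c V * proj1 c V = 0 := by
  have := congrArg Matrix.transpose (proj1_mul_projE c V)
  rwa [Matrix.transpose_mul, transpose_projE, transpose_proj1, Matrix.transpose_zero] at this

variable {c V}

theorem finrank_range_projE (q : ℕ) :
    Module.finrank ℝ (lmulOp q (projE c V)).range = dof q c V := by
  have := finrank_range_lmulOp (q := q) (projE_mul_projE c V)
  rw [trace_projE] at this
  exact_mod_cast this

theorem finrank_range_proj1 (q : ℕ) (hne : ∀ k ∈ tested V, (cluster c k).Nonempty) :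
    Module.finrank ℝ (lmulOp q (proj1 c V)).range = dofStar q c V := by
  have := finrank_range_lmulOp (q := q) (proj1_mul_proj1 c V)
  rw [trace_proj1 c V hne] at this
  exact_mod_cast this

theorem range_projE_isOrtho_range_proj1 (q : ℕ) :
    (lmulOp q (projE c V)).range ⟂ (lmulOp q (proj1 c V)).range := by
  rw [Submodule.isOrtho_iff_inner_eq]
  rintro _ ⟨x, rfl⟩ _ ⟨y, rfl⟩
  rw [inner_lmulOp_left, transpose_projE, lmulOp_apply, lmulOp_apply, ← lmul_mul, projE_mul_proj1,
    lmul_zero]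
  simp

/-- The contrast of a selected pair is nonzero: as the two indices differ, its entry at a member of
the first cluster is the inverse of the size of that cluster. Positivity of `q` comes from `d* > 0`.
-/
theorem dof_pos {q : ℕ} (hV : ∀ p ∈ V, p.1 < p.2) (h : WellPosed q c V) : 0 < dof q c V := by
  obtain ⟨⟨p, hp⟩, hne, hd⟩ := h
  have hq : 0 < q := Nat.pos_of_ne_zero fun h0 => by simp [dofStar, h0] at hd
  refine Nat.mul_pos hq (Module.finrank_pos_iff_exists_ne_zero.2 ?_)
  refine ⟨⟨contrast c p.1 p.2, Submodule.subset_span ⟨p, hp, rfl⟩⟩, fun h0 => ?_⟩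
  have h0' : contrast c p.1 p.2 = 0 := congrArg Subtype.val h0
  obtain ⟨i, hi⟩ := hne p.1 (by simp only [tested, Finset.mem_filter, Finset.mem_univ, true_and]; exact ⟨p.2, Or.inl hp⟩)
  have hi' := (mem_cluster c).1 hi
  have := congrArg (fun v : EuclideanSpace ℝ (Fin n) => v.ofLp i) h0'
  have hlt := hV p hp
  simp only [contrast, hi', if_true, if_neg hlt.ne, sub_zero, PiLp.zero_apply, inv_eq_zero] at this
  rw [← hi'] at this
  exact card_cluster_ne_zero c i this

theorem lmul_proj1_eq_zero {q : ℕ} {μ : Data n q} (h : NullStar μ c V) :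
    lmul (proj1 c V) μ = 0 := by
  ext i a
  rw [lmul_apply_apply, proj1_mulVec_eq_zero]
  · rfl
  intro i j hi hj
  simp only [tested, Finset.mem_filter, Finset.mem_univ, true_and] at hi
  obtain ⟨k', hk | hk⟩ := hi
  · rw [h _ hk j (by simp [mem_cluster, hj]) i (by simp [mem_cluster])]
  · rw [h _ hk j (by simp [mem_cluster, hj]) i (by simp [mem_cluster])]

/-- The inner product of a contrast with a column of `μ` is a difference of two cluster means, which
agree under the null hypothesis. Nonemptiness is needed for these means to be genuine averages. -/
theorem lmul_projE_eq_zero {q : ℕ} {μ : Data n q} (h : NullStar μ c V)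
    (hne : ∀ k ∈ tested V, (cluster c k).Nonempty) : lmul (projE c V) μ = 0 := by
  ext i a
  rw [lmul_apply_apply]
  have h1 := toLp_projE_mulVec c V fun j => μ j a
  rw [(Submodule.starProjection_apply_eq_zero_iff _).2] at h1
  · exact congrArg (fun v : EuclideanSpace ℝ (Fin n) => v.ofLp i) h1
  rw [contrastSpace, Submodule.mem_orthogonal]
  intro u hu
  induction hu using Submodule.span_induction with
  | zero => simp
  | add x y _ _ hx hy => rw [inner_add_left, hx, hy, add_zero]
  | smul t x _ hx => rw [inner_smul_left, hx, mul_zero]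
  | mem x hx =>
    obtain ⟨p, hp, rfl⟩ := hx
    have ht1 : p.1 ∈ tested V := by
      simp only [tested, Finset.mem_filter, Finset.mem_univ, true_and]; exact ⟨p.2, Or.inl hp⟩
    have ht2 : p.2 ∈ tested V := by
      simp only [tested, Finset.mem_filter, Finset.mem_univ, true_and]; exact ⟨p.1, Or.inr hp⟩
    obtain ⟨i₀, hi₀⟩ := hne _ ht1
    have hc : ∀ k ∈ tested V, (∀ j ∈ cluster c k, μ j = μ i₀) →
        ∑ j, (if c j = k then ((cluster c k).card : ℝ)⁻¹ else 0) * μ j a = μ i₀ a := by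
      intro k hk hj
      simp only [ite_mul, zero_mul]
      rw [sum_cluster_ite, Finset.sum_congr rfl fun j hj' => by rw [hj j hj'], Finset.sum_const,
        nsmul_eq_mul, mul_inv_cancel_left₀]
      exact Nat.cast_ne_zero.2 (hne k hk).card_ne_zero
    have e1 := hc p.1 ht1 fun j hj => h p hp j (Finset.mem_union_left _ hj) i₀
      (Finset.mem_union_left _ hi₀)
    have e2 := hc p.2 ht2 fun j hj => h p hp j (Finset.mem_union_right _ hj) i₀
      (Finset.mem_union_left _ hi₀)
    have : ⟪contrast c p.1 p.2, WithLp.toLp 2 fun j => μ j a⟫ =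
        ∑ j, ((if c j = p.1 then ((cluster c p.1).card : ℝ)⁻¹ else 0) * μ j a -
          (if c j = p.2 then ((cluster c p.2).card : ℝ)⁻¹ else 0) * μ j a) := by
      rw [PiLp.inner_apply]
      refine Finset.sum_congr rfl fun j _ => ?_
      rw [← sub_mul]
      simp [contrast, mul_comm]
    rw [this, Finset.sum_sub_distrib, e1, e2, sub_self]

end Projections

end ClusterTest

namespace ClusterTest

open scoped RealInnerProductSpace

/-! ### Standardizing the data -/

section Law

variable {Ω : Type*} [MeasurableSpace Ω] {P : Measure Ω} [IsProbabilityMeasure P] {n q K : ℕ}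

theorem map_standardize_multivariateGaussian (m : EuclideanSpace ℝ (Fin q)) {σ : ℝ} (hσ : 0 < σ) :
    (multivariateGaussian m (σ ^ 2 • (1 : Matrix (Fin q) (Fin q) ℝ))).map
      (fun x => σ⁻¹ • (x - m)) = stdGaussian (EuclideanSpace ℝ (Fin q)) := by
  set N := multivariateGaussian m (σ ^ 2 • (1 : Matrix (Fin q) (Fin q) ℝ))
  have hm : Measurable fun x : EuclideanSpace ℝ (Fin q) => σ⁻¹ • (x - m) := by fun_prop
  have := Measure.isProbabilityMeasure_map (μ := N) hm.aemeasurable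
  refine Measure.ext_of_charFun ?_
  ext t
  have h1 : N.map (fun x => σ⁻¹ • (x - m)) = (N.map fun x => x + -m).map fun x => σ⁻¹ • x := by
    rw [Measure.map_map (by fun_prop) (by fun_prop)]
    rfl
  have hpos : (σ ^ 2 • (1 : Matrix (Fin q) (Fin q) ℝ)).PosSemidef :=
    Matrix.PosSemidef.one.smul (by positivity)
  rw [h1, charFun_map_smul, charFun_map_add_const, charFun_multivariateGaussian hpos,
    charFun_stdGaussian, ← Complex.exp_add]
  congr 1
  have h2 : ((σ⁻¹ • t).ofLp ⬝ᵥ (σ ^ 2 • (1 : Matrix (Fin q) (Fin q) ℝ)).mulVec (σ⁻¹ • t).ofLp)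
      = ‖t‖ ^ 2 := by
    rw [EuclideanSpace.real_norm_sq_eq]
    simp only [Matrix.smul_mulVec, Matrix.one_mulVec, dotProduct, Pi.smul_apply, WithLp.ofLp_smul,
      smul_eq_mul]
    refine Finset.sum_congr rfl fun i _ => ?_
    field_simp
  rw [h2, real_inner_comm m, inner_neg_left, real_inner_comm]
  push_cast
  ring

/-- The standardized data matrix. -/
def standardize (μ : Data n q) (σ : ℝ) (A : Data n q) : FrobSpace n q :=
  WithLp.toLp 2 fun i => σ⁻¹ • (A i - μ i)

theorem measurable_standardize (μ : Data n q) (σ : ℝ) : Measurable (standardize μ σ) := by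
  unfold standardize; fun_prop

theorem add_smul_standardize (μ : Data n q) {σ : ℝ} (hσ : 0 < σ) (A : Data n q) :
    μ + σ • (standardize μ σ A).ofLp = A := by
  ext1 i
  simp [standardize, smul_smul, hσ.ne']

theorem map_standardize {μ : Data n q} {σ : ℝ} (hσ : 0 < σ) {X : Ω → Data n q} (hX : Measurable X)
    (hindep : iIndepFun (fun i ω => X ω i) P)
    (hlaw : ∀ i, HasLaw (fun ω => X ω i)
      (multivariateGaussian (μ i) (σ ^ 2 • (1 : Matrix (Fin q) (Fin q) ℝ))) P) :
    P.map (fun ω => standardize μ σ (X ω)) = stdGaussian (FrobSpace n q) := by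
  have hmi : ∀ i, Measurable fun x : EuclideanSpace ℝ (Fin q) => σ⁻¹ • (x - μ i) := fun i => by
    fun_prop
  have hl : ∀ i, P.map (fun ω => σ⁻¹ • (X ω i - μ i)) = stdGaussian (EuclideanSpace ℝ (Fin q)) := by
    intro i
    rw [← map_standardize_multivariateGaussian (μ i) hσ, ← (hlaw i).map_eq,
      Measure.map_map (hmi i) (by fun_prop)]
    rfl
  have hi : iIndepFun (fun i ω => σ⁻¹ • (X ω i - μ i)) P := hindep.comp _ hmi
  rw [iIndepFun_iff_charFun_pi (fun i => by fun_prop)] at hi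
  have hms : Measurable fun ω => standardize μ σ (X ω) := (measurable_standardize μ σ).comp hX
  have := Measure.isProbabilityMeasure_map (μ := P) hms.aemeasurable
  refine Measure.ext_of_charFun ?_
  ext t
  have h := hi t
  simp only [hl, charFun_stdGaussian] at h
  refine h.trans ?_
  rw [charFun_stdGaussian, ← Complex.exp_sum]
  congr 1
  rw [← Finset.sum_div, Finset.sum_neg_distrib]
  have := PiLp.norm_sq_eq_of_L2 _ t
  congr 2
  exact_mod_cast this.symm

end Law

/-! ### The statistics in terms of the standardized data -/

section Statistic

variable {n q K : ℕ} {c : Fin n → Fin K} {V : Finset (Fin K × Fin K)} {μ : Data n q} {σ : ℝ}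

theorem lmul_add_smul {M : Matrix (Fin n) (Fin n) ℝ} (hM : lmul M μ = 0) (A : Data n q) :
    lmul M (μ + σ • A) = σ • lmul M A := by
  have h1 := (lmulOp q M).map_add (WithLp.toLp 2 μ) (σ • WithLp.toLp 2 A)
  rw [LinearMap.map_smul] at h1
  have h2 := congrArg (fun x : FrobSpace n q => x.ofLp) h1
  change lmul M (μ + σ • A) = lmul M μ + σ • lmul M A at h2
  rw [h2, hM, zero_add]

theorem frobSq_smul (a : ℝ) (A : Data n q) : frobSq (a • A) = a ^ 2 * frobSq A := by
  simp only [frobSq, Pi.smul_apply, norm_smul, mul_pow, Finset.mul_sum, Real.norm_eq_abs, sq_abs]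

theorem frobSq_nonneg (A : Data n q) : 0 ≤ frobSq A := Finset.sum_nonneg fun _ _ => by positivity

theorem frob_smul {a : ℝ} (ha : 0 ≤ a) (A : Data n q) : frob (a • A) = a * frob A := by
  rw [frob, frobSq_smul, Real.sqrt_mul (by positivity), Real.sqrt_sq ha, frob]

theorem inv_frob_smul_smul (hσ : 0 < σ) (A : Data n q) :
    (frob (σ • A))⁻¹ • (σ • A) = (frob A)⁻¹ • A := by
  rw [frob_smul hσ.le, smul_smul]
  congr 1
  field_simp

theorem lmul_proj2 (A : Data n q) :
    lmul (proj2 c V) A = A - lmul (projE c V) A - lmul (proj1 c V) A := by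
  ext i : 1
  simp [lmul, proj2, sub_smul, Finset.sum_sub_distrib, Matrix.one_apply, ite_smul]

theorem tStar_eq_normSqRatio (hσ : 0 < σ) (hE : lmul (projE c V) μ = 0)
    (h1 : lmul (proj1 c V) μ = 0) (hne : ∀ k ∈ tested V, (cluster c k).Nonempty)
    (g : FrobSpace n q) : tStar c V (μ + σ • g.ofLp) =
      normSqRatio (lmulOp q (projE c V)).range (lmulOp q (proj1 c V)).range g := by
  rw [tStar, normSqRatio, lmul_add_smul hE, lmul_add_smul h1, frobSq_smul, frobSq_smul,
    starProjection_range_lmulOp (transpose_projE c V) (projE_mul_projE c V),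
    starProjection_range_lmulOp (transpose_proj1 c V) (proj1_mul_proj1 c V),
    norm_sq_toLp, norm_sq_toLp, finrank_range_projE, finrank_range_proj1 q hne]
  field_simp

/-- Although `Z*` involves `μ` and `σ`, these enter only through a fixed measurable map applied to
`polarRest`, so independence carries over. -/
theorem zStar_eq_polarRest (hσ : 0 < σ) (hE : lmul (projE c V) μ = 0)
    (h1 : lmul (proj1 c V) μ = 0) (g : FrobSpace n q) : zStar c V (μ + σ • g.ofLp) =
      (fun p : FrobSpace n q × FrobSpace n q × ℝ × FrobSpace n q =>
        (p.1.ofLp, p.2.1.ofLp, σ ^ 2 * p.2.2.1, μ + σ • p.2.2.2.ofLp))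
      (polarRest (lmulOp q (projE c V)).range (lmulOp q (proj1 c V)).range g) := by
  simp only [zStar, polarRest, lmul_proj2]
  rw [lmul_add_smul hE, lmul_add_smul h1, frobSq_smul, frobSq_smul,
    starProjection_range_lmulOp (transpose_projE c V) (projE_mul_projE c V),
    starProjection_range_lmulOp (transpose_proj1 c V) (proj1_mul_proj1 c V),
    norm_sq_toLp, norm_sq_toLp, norm_toLp, norm_toLp, inv_frob_smul_smul hσ, inv_frob_smul_smul hσ]
  refine Prod.ext rfl (Prod.ext rfl (Prod.ext ?_ ?_))
  · simp only; ring
  · simp only [WithLp.ofLp_sub, smul_sub]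
    abel

theorem tStar_nonneg (A : Data n q) : 0 ≤ tStar c V A := by
  have := frobSq_nonneg (lmul (projE c V) A)
  have := frobSq_nonneg (lmul (proj1 c V) A)
  unfold tStar
  positivity

theorem xStar_tStar {A : Data n q} (hd : 0 < dof q c V) (hd' : 0 < dofStar q c V)
    (hE : 0 < frobSq (lmul (projE c V) A)) (h1 : 0 < frobSq (lmul (proj1 c V) A)) :
    xStar c V A (tStar c V A) = A := by
  have hdr : (0 : ℝ) < dof q c V := by exact_mod_cast hd
  have hdr' : (0 : ℝ) < dofStar q c V := by exact_mod_cast hd'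
  simp only [xStar, tStar, lmul_proj2, frob]
  set a := frobSq (lmul (projE c V) A)
  set b := frobSq (lmul (proj1 c V) A)
  -- At `ψ = T*` the two weights become the shares of `a` and `b` in `a + b`, so each direction
  -- regains its original length.
  have e1 : a / dof q c V / (b / dofStar q c V) /
      (a / dof q c V / (b / dofStar q c V) + dofStar q c V / dof q c V) = a / (a + b) := by
    field_simp
  have e2 : (dofStar q c V / dof q c V : ℝ) /
      (a / dof q c V / (b / dofStar q c V) + dofStar q c V / dof q c V) = b / (a + b) := by
    field_simp
  rw [e1, e2, Real.sqrt_div hE.le, Real.sqrt_div h1.le, smul_add, smul_smul, smul_smul, smul_smul,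
    smul_smul]
  have hab : √(a + b) ≠ 0 := (Real.sqrt_pos.2 (add_pos hE h1)).ne'
  have ha : √a ≠ 0 := (Real.sqrt_pos.2 hE).ne'
  have hb : √b ≠ 0 := (Real.sqrt_pos.2 h1).ne'
  have f1 : √(a + b) * (√a / √(a + b) * (√a)⁻¹) = 1 := by field_simp
  have f2 : √(a + b) * (√b / √(a + b) * (√b)⁻¹) = 1 := by field_simp
  simp only [mul_assoc, f1, f2, one_smul]
  abel

end Statistic

/-! ### Conditioning on the selected clusters and pairs -/

section Selection

variable {Ω : Type*} [MeasurableSpace Ω] {P : Measure Ω} {n q K : ℕ}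
  {X : Ω → Data n q} {μ : Data n q} {σ : ℝ}

theorem indepFun_tStar_zStar (hσ : 0 < σ) (hX : Measurable X)
    (hG : P.map (fun ω => standardize μ σ (X ω)) = stdGaussian (FrobSpace n q))
    {c : Fin n → Fin K} {V : Finset (Fin K × Fin K)} (hVlt : ∀ p ∈ V, p.1 < p.2)
    (hnull : NullStar μ c V) (hwp : WellPosed q c V) :
    IndepFun (fun ω => tStar c V (X ω)) (fun ω => zStar c V (X ω)) P ∧
      P.map (fun ω => tStar c V (X ω)) = fDist (dof q c V) (dofStar q c V) ∧
      ∀ᵐ ω ∂P, xStar c V (X ω) (tStar c V (X ω)) = X ω := by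
  have hE := lmul_projE_eq_zero hnull hwp.2.1
  have h1 := lmul_proj1_eq_zero hnull
  have hd := dof_pos hVlt hwp
  have hd' := hwp.2.2
  have hGm : Measurable fun ω => standardize μ σ (X ω) := (measurable_standardize μ σ).comp hX
  have hU := finrank_range_projE (c := c) (V := V) q
  have hW := finrank_range_proj1 (c := c) (V := V) q hwp.2.1
  have hUp : 0 < Module.finrank ℝ (lmulOp q (projE c V)).range := hU ▸ hd
  have hWp : 0 < Module.finrank ℝ (lmulOp q (proj1 c V)).range := hW ▸ hd'
  have ht : ∀ ω, tStar c V (X ω) = normSqRatio (lmulOp q (projE c V)).range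
      (lmulOp q (proj1 c V)).range (standardize μ σ (X ω)) := fun ω => by
    rw [← tStar_eq_normSqRatio hσ hE h1 hwp.2.1, add_smul_standardize μ hσ]
  have hz := fun ω => zStar_eq_polarRest hσ hE h1 (standardize μ σ (X ω))
  simp only [add_smul_standardize μ hσ] at hz
  refine ⟨?_, ?_, ?_⟩
  · simp only [ht, hz]
    refine IndepFun.comp (φ := id) (indepFun_comp_of_map hGm (measurable_normSqRatio _ _)
      (measurable_polarRest _ _) ?_) measurable_id
      (ψ := fun p : FrobSpace n q × FrobSpace n q × ℝ × FrobSpace n q =>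
        (p.1.ofLp, p.2.1.ofLp, σ ^ 2 * p.2.2.1, μ + σ • p.2.2.2.ofLp)) (by fun_prop)
    rw [hG]
    exact indepFun_normSqRatio_polarRest (range_projE_isOrtho_range_proj1 q) hUp hWp
  · simp only [ht]
    rw [← hU, ← hW, ← map_normSqRatio_stdGaussian (range_projE_isOrtho_range_proj1 q), ← hG,
      Measure.map_map (measurable_normSqRatio _ _) hGm]
    rfl
  · have hpos : ∀ {M : Matrix (Fin n) (Fin n) ℝ}, M.transpose = M → M * M = M → lmul M μ = 0 →
        0 < Module.finrank ℝ (lmulOp q M).range → ∀ᵐ ω ∂P, 0 < frobSq (lmul M (X ω)) := by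
      intro M hM hM2 hMμ hMp
      have h := ae_orthogonalProjectionOnto_ne_zero hMp
      rw [← hG] at h
      filter_upwards [ae_of_ae_map hGm.aemeasurable h] with ω hω
      rw [starProjection_range_lmulOp hM hM2] at hω
      rw [← add_smul_standardize μ hσ (X ω), lmul_add_smul hMμ, frobSq_smul, ← norm_sq_toLp]
      have := norm_pos_iff.2 hω
      positivity
    filter_upwards [hpos (transpose_projE c V) (projE_mul_projE c V) hE hUp,
      hpos (transpose_proj1 c V) (proj1_mul_proj1 c V) h1 hWp] with ω h2 h3
    exact xStar_tStar hd hd' h2 h3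

variable {J : ℕ} {C : Data n q → Fin (J + 1) → Fin n → Fin K}
  {V : Data n q → Finset (Fin K × Fin K)}

theorem measurableSet_truncSet (hC : Measurable C) (hV : Measurable V) (A : Data n q) :
    MeasurableSet (truncSet C V A) := by
  have hm : Measurable fun ψ => xStar (final (C A)) (V A) A ψ :=
    (measurable_rebuild ((dofStar q (final (C A)) (V A) : ℝ) / dof q (final (C A)) (V A))).comp
      (measurable_prodMk_left (x := zStar (final (C A)) (V A) A))
  have h : truncSet C V A = (Set.Ici 0 ∩ (fun ψ => C (xStar (final (C A)) (V A) A ψ)) ⁻¹' {C A}) ∩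
      (Set.Ici 0 ∩ (fun ψ => V (xStar (final (C A)) (V A) A ψ)) ⁻¹' {V A}) := by
    ext ψ
    simp only [truncSet, Set.mem_inter_iff, Set.mem_ofPred_eq, Set.mem_Ici, Set.mem_preimage,
      Set.mem_singleton_iff, eq_comm]
  rw [h]
  exact (measurableSet_Ici.inter ((hC.comp hm) (measurableSet_singleton _))).inter
    (measurableSet_Ici.inter ((hV.comp hm) (measurableSet_singleton _)))

/-- Under the null hypothesis, the conditional law of the statistic given the selection event and
`Z*` is the truncated `F` distribution. -/
theorem condDistrib_selT_selW [IsProbabilityMeasure P] (hσ : 0 < σ) (hX : Measurable X)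
    (hG : P.map (fun ω => standardize μ σ (X ω)) = stdGaussian (FrobSpace n q))
    (hC : Measurable C) (hV : Measurable V) (hVlt : ∀ A, ∀ p ∈ V A, p.1 < p.2) :
    ∀ᵐ ω ∂P, NullStar μ (final (C (X ω))) (V (X ω)) → WellPosed q (final (C (X ω))) (V (X ω)) →
      condDistrib (fun ω' => selT C V (X ω')) (fun ω' => selW C V (X ω')) P (selW C V (X ω)) =
        cond (fDist (dof q (final (C (X ω))) (V (X ω))) (dofStar q (final (C (X ω))) (V (X ω))))
          (truncSet C V (X ω)) := by
  -- There are finitely many outcomes, so each can be treated separately, with the projections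
  -- deterministic. Outcomes that violate the hypotheses are vacuous.
  suffices h : ∀ l : (Fin (J + 1) → Fin n → Fin K) × Finset (Fin K × Fin K), ∀ᵐ ω ∂P,
      (C (X ω) = l.1 ∧ V (X ω) = l.2) →
      NullStar μ (final (C (X ω))) (V (X ω)) → WellPosed q (final (C (X ω))) (V (X ω)) →
      condDistrib (fun ω' => selT C V (X ω')) (fun ω' => selW C V (X ω')) P (selW C V (X ω)) =
        cond (fDist (dof q (final (C (X ω))) (V (X ω))) (dofStar q (final (C (X ω))) (V (X ω))))
          (truncSet C V (X ω)) by
    filter_upwards [ae_all_iff.2 h] with ω hω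
    exact hω (C (X ω), V (X ω)) ⟨rfl, rfl⟩
  rintro ⟨C₀, V₀⟩
  by_cases hgood : (∀ p ∈ V₀, p.1 < p.2) ∧ NullStar μ (final C₀) V₀ ∧ WellPosed q (final C₀) V₀
  swap
  · refine Filter.Eventually.of_forall fun ω hω hn hw => absurd ⟨?_, ?_, ?_⟩ hgood
    · have := hVlt (X ω)
      rw [hω.2] at this; exact this
    · rw [hω.1, hω.2] at hn; exact hn
    · rw [hω.1, hω.2] at hw; exact hw
  obtain ⟨hlt, hnull, hwp⟩ := hgood
  obtain ⟨hind, hlawT, hrec⟩ := indepFun_tStar_zStar hσ hX hG hlt hnull hwp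
  set r : ℝ := (dofStar q (final C₀) V₀ : ℝ) / dof q (final C₀) V₀ with hr
  have hreb := measurable_rebuild (n := n) (q := q) r
  have h := condDistrib_eq_cond_section (P := P)
    (T₀ := fun ω => tStar (final C₀) V₀ (X ω)) (T := fun ω => selT C V (X ω))
    (Z₀ := fun ω => zStar (final C₀) V₀ (X ω)) (W := fun ω => selW C V (X ω))
    ((measurable_tStar _ _).comp hX) ((measurable_selT hC hV).comp hX)
    ((measurable_zStar _ _).comp hX) ((measurable_selW hC hV).comp hX) hind
    (B := {b | b.1 = C₀ ∧ b.2.1 = V₀})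
    ((measurableSet_eq_fun measurable_fst measurable_const).inter
      (measurableSet_eq_fun measurable_snd.fst measurable_const))
    -- The selection event written through `(Z*, T*)`, by means of `X = x*(T*)`. The sign condition
    -- costs nothing, as `T* ≥ 0`, and makes the sections equal to the truncation set.
    (D := {p | 0 ≤ p.2 ∧ C (rebuild r p.1 p.2) = C₀ ∧ V (rebuild r p.1 p.2) = V₀})
    ((measurableSet_le measurable_const measurable_snd).inter
      ((measurableSet_eq_fun (hC.comp hreb) measurable_const).inter
        (measurableSet_eq_fun (hV.comp hreb) measurable_const)))
    (e := fun z => (C₀, V₀, z)) (by fun_prop) (g := fun b => b.2.2) (by fun_prop) (fun z => rfl)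
    (by
      filter_upwards [hrec] with ω hω
      rw [xStar_eq_rebuild, ← hr] at hω
      change (C (X ω) = C₀ ∧ V (X ω) = V₀) ↔ (0 ≤ tStar (final C₀) V₀ (X ω) ∧
        C (rebuild r (zStar (final C₀) V₀ (X ω)) (tStar (final C₀) V₀ (X ω))) = C₀ ∧
        V (rebuild r (zStar (final C₀) V₀ (X ω)) (tStar (final C₀) V₀ (X ω))) = V₀)
      rw [hω]
      simp [tStar_nonneg])
    (by
      refine Filter.Eventually.of_forall fun ω hω => ?_
      obtain ⟨h1, h2⟩ : C (X ω) = C₀ ∧ V (X ω) = V₀ := hω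
      simp only [selW, selT, h1, h2, and_self])
  filter_upwards [h] with ω hω hl _ _
  rw [hω hl, hlawT]
  obtain ⟨h1, h2⟩ : C (X ω) = C₀ ∧ V (X ω) = V₀ := hl
  simp only [h1, h2]
  congr 1
  ext ψ
  simp only [truncSet, xStar_eq_rebuild, h1, h2, ← hr, Set.mem_preimage, Set.mem_ofPred_eq,
    Set.mem_inter_iff]
  constructor
  · rintro ⟨a, b, c⟩
    exact ⟨⟨a, b.symm⟩, a, c.symm⟩
  · rintro ⟨⟨a, b⟩, -, c⟩
    exact ⟨a, b.symm, c.symm⟩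

end Selection

end ClusterTest

end

theorem mainTheorem3 {Ω : Type*} [MeasurableSpace Ω] (P : Measure Ω) [IsProbabilityMeasure P]
    {n q K J : ℕ} [NeZero K]
    -- K-means clustering, run for `J` iterations, with an arbitrary initialization rule
    (m₀ : ClusterTest.Data n q → Fin K → EuclideanSpace ℝ (Fin q)) (hm₀ : Measurable m₀)
    -- the rule that selects the pairs of clusters from the data
    (V : ClusterTest.Data n q → Finset (Fin K × Fin K)) (hV : Measurable V)
    (hVall : ∀ A, ∀ p ∈ V A, p.1 < p.2)
    -- the data: independent rows, the `i`-th one with law `N(μ i, σ² I)`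
    (μ : ClusterTest.Data n q) (σ : ℝ) (hσ : 0 < σ)
    (X : Ω → ClusterTest.Data n q) (hX : Measurable X)
    (hindep : iIndepFun (fun i ω => X ω i) P)
    (hlaw : ∀ i, HasLaw (fun ω => X ω i)
      (multivariateGaussian (μ i) (σ ^ 2 • (1 : Matrix (Fin q) (Fin q) ℝ))) P) :
    let C := ClusterTest.kmeans m₀ J
    -- the conditional distribution function is that of the truncated `F` distribution
    (∀ᵐ ω ∂P,
      let c := ClusterTest.final (C (X ω))
      ClusterTest.NullStar μ c (V (X ω)) → ClusterTest.WellPosed q c (V (X ω)) →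
        ∀ t : ℝ, ClusterTest.Qstar P C V X ω t =
          ClusterTest.truncCDF
            (ClusterTest.fDist (ClusterTest.dof q c (V (X ω))) (ClusterTest.dofStar q c (V (X ω))))
            (ClusterTest.truncSet C V (X ω)) t) ∧
    -- the p-value (and its complement) is uniform conditionally on `𝒞(X)` and `𝒱(X)`
    (∀ α ∈ Set.Icc (0 : ℝ) 1, ∀ᵐ ω ∂P,
      let c := ClusterTest.final (C (X ω))
      ClusterTest.NullStar μ c (V (X ω)) → ClusterTest.WellPosed q c (V (X ω)) →
        (P⟦{ω' | ClusterTest.pStar P C V X ω' ≤ α} |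
            MeasurableSpace.comap (fun ω' => (C (X ω'), V (X ω'))) inferInstance⟧) ω = α ∧
        (P⟦{ω' | ClusterTest.Qstar P C V X ω' (ClusterTest.selT C V (X ω')) ≤ α} |
            MeasurableSpace.comap (fun ω' => (C (X ω'), V (X ω'))) inferInstance⟧) ω = α) := by
  intro C
  have hC : Measurable C := ClusterTest.measurable_kmeans hm₀ J
  have hcd := ClusterTest.condDistrib_selT_selW hσ hX
    (ClusterTest.map_standardize hσ hX hindep hlaw) hC hV hVall
  refine ⟨?_, fun α hα => ?_⟩
  · filter_upwards [hcd] with ω hω c hn hw t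
    have hS := ClusterTest.measurableSet_truncSet hC hV (X ω)
    change ClusterTest.condDF P _ _ ω t = ClusterTest.truncCDF _ _ t
    rw [ClusterTest.condDF, cdf_eq_real, hω hn hw, ClusterTest.truncCDF,
      measureReal_def, cond_apply hS, ENNReal.toReal_mul, ENNReal.toReal_inv, div_eq_inv_mul]
    rfl
  · refine ClusterTest.condExp_condDF_uniform (P := P)
      (W := fun ω => ClusterTest.selW C V (X ω)) (T := fun ω => ClusterTest.selT C V (X ω))
      ((ClusterTest.measurable_selW hC hV).comp hX) ((ClusterTest.measurable_selT hC hV).comp hX)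
      -- The coarser statistic forgets `Z*`.
      (φ := fun b => (b.1, b.2.1)) (by fun_prop)
      (s := {l | ClusterTest.NullStar μ (ClusterTest.final l.1) l.2 ∧
        ClusterTest.WellPosed q (ClusterTest.final l.1) l.2}) (Set.to_countable _).measurableSet
      ?_ hα |>.mono fun ω hω hn hw => hω ⟨hn, hw⟩
    filter_upwards [hcd] with ω hω hs
    obtain ⟨hn, hw⟩ : ClusterTest.NullStar μ (ClusterTest.final (C (X ω))) (V (X ω)) ∧
      ClusterTest.WellPosed q (ClusterTest.final (C (X ω))) (V (X ω)) := hs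
    rw [hω hn hw]
    -- Truncation preserves null sets, so the conditional law inherits the absence of atoms from the
    -- `F` law.
    have := ClusterTest.noAtoms_fDist (ClusterTest.dof_pos (hVall (X ω)) hw) hw.2.2
    exact ⟨fun x => cond_absolutelyContinuous (measure_singleton x)⟩
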